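/- Let $\mathbb{R}_n$ be the real Clifford algebra with generators $\mathbf e_1,\dots,\mathbf e_n$, $\mathbf e_r\mathbf e_s+\mathbf e_s\mathbf e_r=-2\delta_{rs}$, and norm $|a|=(\sum_A a_A^2)^{1/2}$ for $a=\sum_A a_A\mathbf e_A$. Let $\mathbb{R}^{n+1}=\{x_0+\underline x\}$ be the space of paravectors, $\mathbb{S}$ the sphere of unit vectors $\underline x\in\mathbb{R}^n$, and $\mathbb{R}^{n+1}_+=\{x_0>0\}=\{u+Iv: u>0,\ v\in\mathbb{R},\ I\in\mathbb{S}\}$. A real differentiable $f:\mathbb{R}^{n+1}_+\to\mathbb{R}_n$ is left slice monogenic if $\frac12(\partial_u+J\partial_v)f(u+Jv)=0$ for all $J\in\mathbb{S}$, $u>0$, $v\in\mathbb{R}$. For $1\le p\le 2$, $H^p_{\rm slice}(\mathbb{R}^{n+1}_+)$ is the set of left slice monogenic $f$ on $\mathbb{R}^{n+1}_+$ that have, for every $J\in\mathbb{S}$, a nontangential boundary limit $f(Jv)$ within the half-plane $\{u+Jv:u>0\}$ at $Jv$ for almost every $v\in\mathbb{R}$, with $\sup_{J\in\mathbb{S}}\int_{\mathbb{R}}|f(Jv)|^p\,dv<\infty$.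 For $I\in\mathbb{S}$ and $g\in L^1(\mathbb{R};\mathbb{R}_n)$ put $\mathscr F_I(g)(w)=\frac1{\sqrt{2\pi}}\int_{\mathbb{R}}e^{-Iuw}g(u)\,du$; for $g\in L^p(\mathbb{R};\mathbb{R}_n)$, $1\le p\le2$, $\frac1p+\frac1q=1$, let $\mathscr F_I(g)\in L^q(\mathbb{R};\mathbb{R}_n)$ be the limit in $L^q$ of $\mathscr F_I(g\mathbf 1_{[-R,R]})$ as $R\to\infty$. **Theorem.** Let $1\le p\le 2$, $I\in\mathbb{S}$, and let $g\in L^p(\mathbb{R};\mathbb{R}_n)$, regarded as a boundary function $Iv\mapsto g(v)$ on $I\mathbb{R}$, satisfy $\operatorname{supp}\mathscr F_I(g)\subset(-\infty,0]$, i.e. $\mathscr F_I(g)(w)=0$ for almost every $w>0$. Define $f$ on the slice by the Poisson integral $$f(u+Iv)=\int_{\mathbb{R}}\frac{u}{\pi\left(u^2+(v-w)^2\right)}\,g(w)\,dw\qquad(u>0,\ v\in\mathbb{R}),$$ and on $\mathbb{R}^{n+1}_+$ by $$f(u+Jv)=\tfrac12\left[f(u-Iv)+f(u+Iv)\right]+\tfrac{JI}{2}\left[f(u-Iv)-f(u+Iv)\right]\qquad(J\in\mathbb{S}).$$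 Then $f\in H^p_{\rm slice}(\mathbb{R}^{n+1}_+)$, and the nontangential boundary limit of $f$ at $Iv$ is $g(v)$ for almost every $v\in\mathbb{R}$. Moreover, $\sup_{J\in\mathbb{S}}\sup_{u>0}\int_{\mathbb{R}}|f(u+Jv)|^p\,dv<\infty$. -/

import Mathlib

open MeasureTheory Filter Topology
open scoped ENNReal

noncomputable section

namespace SliceHardy

/-! ### The real Clifford algebra `ℝ_n` and its Euclidean norm -/

/-- The bilinear form `-⟪x, y⟫` on `ℝ^n`. -/
def negInner (n : ℕ) : LinearMap.BilinForm ℝ (EuclideanSpace ℝ (Fin n)) :=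
  -(innerₗ (EuclideanSpace ℝ (Fin n)))

/-- The quadratic form `x ↦ -|x|^2` on `ℝ^n`. -/
def cliffQ (n : ℕ) : QuadraticForm ℝ (EuclideanSpace ℝ (Fin n)) :=
  (negInner n).toQuadraticMap

/-- The real Clifford algebra `ℝ_n` with `e_r e_s + e_s e_r = -2 δ_{rs}`. -/
abbrev Cl (n : ℕ) : Type := CliffordAlgebra (cliffQ n)

/-- The inclusion of the vectors `ℝ_n^1 = ℝ^n` into `ℝ_n`. -/
abbrev vec {n : ℕ} (x : EuclideanSpace ℝ (Fin n)) : Cl n := CliffordAlgebra.ι (cliffQ n) x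

/-- The standard basis vector `e_i` of `ℝ^n`. -/
def stdVec (n : ℕ) (i : Fin n) : EuclideanSpace ℝ (Fin n) := EuclideanSpace.single i 1

theorem vec_mul_self {n : ℕ} (x : EuclideanSpace ℝ (Fin n)) :
    vec x * vec x = algebraMap ℝ (Cl n) (-(‖x‖ ^ 2)) := by
  have h : cliffQ n x = -(‖x‖ ^ 2) := by
    simp [cliffQ, negInner, LinearMap.BilinMap.toQuadraticMap_apply]
  rw [CliffordAlgebra.ι_sq_scalar, h]

/-- The basis of `ℝ_n` transported from the exterior algebra; it consists of the products `e_A`, see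
`cliffBasis_apply`. -/
def cliffBasis (n : ℕ) : Module.Basis (Finset (Fin n)) ℝ (Cl n) :=
  (EuclideanSpace.basisFun (Fin n) ℝ).toBasis.ExteriorAlgebra.map
    (CliffordAlgebra.changeFormEquiv (Q := (0 : QuadraticForm ℝ (EuclideanSpace ℝ (Fin n))))
      (Q' := cliffQ n) (B := negInner n) (by simp [cliffQ]))

theorem contractLeft_prod_eq_zero {n : ℕ} (Q : QuadraticForm ℝ (EuclideanSpace ℝ (Fin n)))
    (d : Module.Dual ℝ (EuclideanSpace ℝ (Fin n))) (l : List (EuclideanSpace ℝ (Fin n)))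
    (h : ∀ x ∈ l, d x = 0) :
    CliffordAlgebra.contractLeft d (l.map (CliffordAlgebra.ι Q)).prod = 0 := by
  induction l with
  | nil => simp
  | cons a l ih =>
    rw [List.map_cons, List.prod_cons, CliffordAlgebra.contractLeft_ι_mul,
      ih (fun x hx => h x (List.mem_cons_of_mem _ hx)), h a List.mem_cons_self]
    simp

theorem changeForm_prod {n : ℕ} (Q Q' : QuadraticForm ℝ (EuclideanSpace ℝ (Fin n)))
    (B : LinearMap.BilinForm ℝ (EuclideanSpace ℝ (Fin n))) (h : B.toQuadraticMap = Q' - Q)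
    (l : List (EuclideanSpace ℝ (Fin n))) (hl : l.Pairwise fun x y => B x y = 0) :
    CliffordAlgebra.changeForm h (l.map (CliffordAlgebra.ι Q)).prod =
      (l.map (CliffordAlgebra.ι Q')).prod := by
  induction l with
  | nil => simp
  | cons a l ih =>
    rw [List.pairwise_cons] at hl
    rw [List.map_cons, List.prod_cons, CliffordAlgebra.changeForm_ι_mul, ih hl.2,
      contractLeft_prod_eq_zero Q' (B a) l hl.1, sub_zero, List.map_cons, List.prod_cons]

/-- The basis element indexed by `A = {i_1 < ... < i_s}` is `e_A = e_{i_1} ... e_{i_s}`. -/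
theorem cliffBasis_apply (n : ℕ) (A : Finset (Fin n)) :
    cliffBasis n A = (A.sort.map fun i => vec (stdVec n i)).prod := by
  have h0 : (EuclideanSpace.basisFun (Fin n) ℝ).toBasis.ExteriorAlgebra A =
      ((A.sort.map (stdVec n)).map
        (CliffordAlgebra.ι (0 : QuadraticForm ℝ (EuclideanSpace ℝ (Fin n))))).prod := by
    rw [ExteriorAlgebra.basis_apply_ofCard _ (rfl : A.card = A.card),
      ExteriorAlgebra.ιMulti_family, ExteriorAlgebra.ιMulti_apply, List.ofFn_eq_map,
      ← Finset.listMap_orderEmbOfFin_finRange A rfl]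
    simp only [List.map_map]
    congr 1
    refine List.map_congr_left fun i _ => ?_
    simp [stdVec, Set.powersetCard.ofFinEmbEquiv_symm_apply, ExteriorAlgebra.ι]
  rw [cliffBasis, Module.Basis.map_apply, h0]
  refine (changeForm_prod _ _ _ (by simp [cliffQ]) _ ?_).trans ?_
  rotate_left
  · rw [List.map_map]
    rfl
  · rw [List.pairwise_map]
    refine (Finset.sort_nodup A (· ≤ ·)).imp fun {i j} hij => ?_
    simp [negInner, stdVec, EuclideanSpace.inner_single_left, hij]

/-- Coordinates `a ↦ (a_A)_A` of a Clifford number, as a point of Euclidean space. -/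
def cliffCoord (n : ℕ) : Cl n ≃ₗ[ℝ] EuclideanSpace ℝ (Finset (Fin n)) :=
  (cliffBasis n).equivFun.trans (WithLp.linearEquiv 2 ℝ (Finset (Fin n) → ℝ)).symm

/-- The norm `|a| = (∑_A a_A^2)^{1/2}` on `ℝ_n`. -/
instance cliffNormed (n : ℕ) : NormedAddCommGroup (Cl n) :=
  NormedAddCommGroup.induced (Cl n) (EuclideanSpace ℝ (Finset (Fin n)))
    (cliffCoord n).toLinearMap (cliffCoord n).injective

instance cliffNormedSpace (n : ℕ) : NormedSpace ℝ (Cl n) :=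
  NormedSpace.induced ℝ (Cl n) (EuclideanSpace ℝ (Finset (Fin n))) (cliffCoord n).toLinearMap

theorem cliff_norm_eq {n : ℕ} (a : Cl n) :
    ‖a‖ = Real.sqrt (∑ A, ((cliffBasis n).repr a A) ^ 2) := by
  change ‖cliffCoord n a‖ = _
  rw [EuclideanSpace.norm_eq]
  simp [cliffCoord]

/-! ### Paravectors, slices, slice monogenic functions -/

/-- The space `ℝ^{n+1}` of paravectors `x_0 + x`, written as pairs `(x_0, x)`. Only its topology and
its real differentiable structure are used, so the product norm is as good as the Euclidean one. -/
abbrev Paravector (n : ℕ) : Type := ℝ × EuclideanSpace ℝ (Fin n)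

/-- The sphere `𝕊` of purely imaginary unit paravectors. -/
def imagSphere (n : ℕ) : Set (EuclideanSpace ℝ (Fin n)) := {J | ‖J‖ = 1}

/-- The point `u + J v` of `ℝ^{n+1}`. -/
def slicePoint {n : ℕ} (J : EuclideanSpace ℝ (Fin n)) (u v : ℝ) : Paravector n := (u, v • J)

/-- The open right half-space `ℝ^{n+1}_+`. -/
def rightHalfSpace (n : ℕ) : Set (Paravector n) := {x | 0 < x.1}

/-- Left slice monogenic functions on an open set `U ⊆ ℝ^{n+1}`: real differentiable, with
`(1/2) (∂_u + J ∂_v) f (u + J v) = 0` on `U ∩ L_J` for every `J ∈ 𝕊`. -/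
def SliceMonogenicOn {n : ℕ} (U : Set (Paravector n)) (f : Paravector n → Cl n) : Prop :=
  DifferentiableOn ℝ f U ∧
    ∀ J ∈ imagSphere n, ∀ u v : ℝ, slicePoint J u v ∈ U →
      (1 / 2 : ℝ) • (deriv (fun s => f (slicePoint J s v)) u +
        vec J * deriv (fun t => f (slicePoint J u t)) v) = 0

/-- `f` has the nontangential boundary limit `b` at the point `J v`, along the slice half-plane
`Π_{+,J}`: in every cone `{s + J t : s > 0, |t - v| < a s}`, `f` tends to `b` at the vertex. -/
def HasNTBL {n : ℕ} (f : Paravector n → Cl n) (J : EuclideanSpace ℝ (Fin n)) (v : ℝ) (b : Cl n) :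
    Prop :=
  ∀ a : ℝ, 0 < a →
    Tendsto (fun z : ℝ × ℝ => f (slicePoint J z.1 z.2))
      (𝓝[{z : ℝ × ℝ | 0 < z.1 ∧ |z.2 - v| < a * z.1}] (0, v)) (𝓝 b)

/-- `f ∈ H^p_slice(ℝ^{n+1}_+)`: `f` is left slice monogenic on the right half-space, on every slice
it has nontangential boundary limits `b J v` at almost every `J v`, and
`sup_{J ∈ 𝕊} ∫ |b J v|^p dv < ∞`. -/
def MemHardySlice {n : ℕ} (p : ℝ) (f : Paravector n → Cl n) : Prop :=
  SliceMonogenicOn (rightHalfSpace n) f ∧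
    ∃ b : EuclideanSpace ℝ (Fin n) → ℝ → Cl n,
      (∀ J ∈ imagSphere n, ∀ᵐ v : ℝ, HasNTBL f J v (b J v)) ∧
      (⨆ J ∈ imagSphere n, ∫⁻ v : ℝ, ‖b J v‖ₑ ^ p) < ⊤

/-! ### The one-dimensional left-sided Clifford Fourier transform -/

/-- `e^{I θ} = cos θ + I sin θ`. -/
def imagExp {n : ℕ} (I : EuclideanSpace ℝ (Fin n)) (θ : ℝ) : Cl n :=
  algebraMap ℝ (Cl n) (Real.cos θ) + Real.sin θ • vec I

/-- `𝓕_I(g)(w) = (2π)^{-1/2} ∫ e^{-I u w} g(u) du` for integrable `g`. -/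
def cliffFourier {n : ℕ} (I : EuclideanSpace ℝ (Fin n)) (g : ℝ → Cl n) (w : ℝ) : Cl n :=
  (Real.sqrt (2 * Real.pi))⁻¹ • ∫ u : ℝ, imagExp I (-(u * w)) * g u

/-- `G ∈ L^q(ℝ)`, `1/p + 1/q = 1`, is the transform `𝓕_I(g)` of `g ∈ L^p(ℝ)`, `1 ≤ p ≤ 2`: it is the
limit in `L^q(ℝ)`, as `R → ∞`, of the transforms of the integrable functions `g 1_{[-R,R]}`. (By the
Hausdorff-Young inequality such a `G` exists for every `g ∈ L^p(ℝ)`, and it is unique a.e.) -/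
def IsCliffFourierLp {n : ℕ} (I : EuclideanSpace ℝ (Fin n)) (p : ℝ) (g G : ℝ → Cl n) : Prop :=
  MemLp G (ENNReal.ofReal p).conjExponent volume ∧
    Tendsto
      (fun R : ℝ => eLpNorm (fun w => cliffFourier I ((Set.Icc (-R) R).indicator g) w - G w)
        (ENNReal.ofReal p).conjExponent volume)
      atTop (𝓝 0)

/-- `supp 𝓕_I(g) ⊆ K` for `g ∈ L^p(ℝ)` and closed `K`: the function `𝓕_I(g) ∈ L^q(ℝ)` vanishes
almost everywhere outside `K`. -/
def CliffFourierSupportedIn {n : ℕ} (I : EuclideanSpace ℝ (Fin n)) (p : ℝ) (g : ℝ → Cl n)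
    (K : Set ℝ) : Prop :=
  ∃ G : ℝ → Cl n, IsCliffFourierLp I p g G ∧ ∀ᵐ w : ℝ, w ∉ K → G w = 0

/-! ### The Poisson integral on a slice and the slice extension -/

/-- The Poisson kernel of the right half-plane. -/
def poissonKernel (u v : ℝ) : ℝ := u / (Real.pi * (u ^ 2 + v ^ 2))

/-- The Poisson integral of boundary values `g(v)`, given at the points `I v`, at the point
`u + I v` of `Π_{+,I}`. -/
def poissonIntegral {n : ℕ} (g : ℝ → Cl n) (u v : ℝ) : Cl n :=
  ∫ w : ℝ, poissonKernel u (v - w) • g w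

/-- The extension of a function `F(u, v) = F(u + I v)` from the slice `L_I` to `ℝ^{n+1}`:
`ext(F)(u + J v) = (1/2) [F(u - I v) + F(u + I v)] + (J I / 2) [F(u - I v) - F(u + I v)]`.
A point `x = x_0 + x'` is written as `u + J v` with `u = x_0`, `v = |x'|`, `J = x' / |x'|`; at a real
point (`x' = 0`) the second bracket is `0`. See `sliceExt_slicePoint` for all `J`, `v`. -/
def sliceExt {n : ℕ} (I : EuclideanSpace ℝ (Fin n)) (F : ℝ → ℝ → Cl n) (x : Paravector n) : Cl n :=
  (1 / 2 : ℝ) • (F x.1 (-‖x.2‖) + F x.1 ‖x.2‖) +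
    (1 / 2 : ℝ) • (vec (‖x.2‖⁻¹ • x.2) * vec I * (F x.1 (-‖x.2‖) - F x.1 ‖x.2‖))

theorem sliceExt_slicePoint {n : ℕ} (I J : EuclideanSpace ℝ (Fin n)) (hJ : J ∈ imagSphere n)
    (F : ℝ → ℝ → Cl n) (u v : ℝ) :
    sliceExt I F (slicePoint J u v) =
      (1 / 2 : ℝ) • (F u (-v) + F u v) + (1 / 2 : ℝ) • (vec J * vec I * (F u (-v) - F u v)) := by
  have hJ1 : ‖J‖ = 1 := hJ
  simp only [sliceExt, slicePoint, norm_smul, hJ1, mul_one, Real.norm_eq_abs]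
  rcases lt_trichotomy v 0 with hv | rfl | hv
  · rw [abs_of_neg hv, neg_neg, smul_smul, inv_neg, neg_mul, inv_mul_cancel₀ hv.ne, neg_smul,
      one_smul, vec, map_neg, add_comm (F u v) (F u (-v))]
    congr 2
    rw [neg_mul, neg_mul, ← mul_neg, neg_sub]
  · simp
  · rw [abs_of_pos hv, smul_smul, inv_mul_cancel₀ hv.ne', one_smul]

end SliceHardy

end

noncomputable section

namespace SliceHardy

/-! Left multiplication by `ℝ + Iℝ`, a copy of `ℂ`, reduces the analysis on the slice of `I` to
complex scalars acting on a finite-dimensional real space.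

The heart is the Cauchy-Riemann equation. Applying `∂_u + I∂_v` to the Poisson kernel at `t = v - w`
gives `-π⁻¹ (u - It)⁻²`, so with `z = u - Iv` one must show `∫ (z + Iw)⁻² g(w) dw = 0`. Since `(z +
Iw)⁻² = ∫_0^∞ s e^{-(z + Iw)s} ds`, Fubini turns the integral over `[-R, R]` into `√(2π) ∫_0^∞ s
e^{-zs} 𝓕_I(g 1_{[-R,R]})(s) ds`. Here `s e^{-zs}` lies in `L^p(0,∞)`, the transforms converge in
`L^q` and their limit vanishes on `(0,∞)`, so Hölder gives `0` as `R → ∞`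
(`integral_sliceMul_inv_sq_eq_zero`, `poissonIntegral_cauchyRiemann`).

The slice extension carries this equation to every slice; at real points the odd bracket vanishes to
first order, which compensates for the discontinuity of `x'/|x'|` (`sliceMonogenicOn_sliceExt`).

Boundary limits hold at Lebesgue points of `g`: a dyadic majorant of the kernel handles radial
approach, and within a cone the kernel is comparable to the one centred at the vertex
(`ae_tendsto_poissonKernel_cone`). The `L^p` means are bounded by Jensen and Tonelli, and passing to
another `J` costs a factor independent of `J` (`exists_lintegral_sliceCombination_le`). -/

/-! ### Clifford multiplication, and slices as copies of `ℂ` -/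

instance cliffFiniteDimensional (n : ℕ) : FiniteDimensional ℝ (Cl n) :=
  Module.Finite.of_basis (cliffBasis n)

/-- Multiplication of `ℝ_n` as a continuous bilinear map. -/
def cliffMul (n : ℕ) : Cl n →L[ℝ] Cl n →L[ℝ] Cl n :=
  LinearMap.toContinuousLinearMap
    ((LinearMap.toContinuousLinearMap : (Cl n →ₗ[ℝ] Cl n) ≃ₗ[ℝ] _).toLinearMap ∘ₗ
      LinearMap.mul ℝ (Cl n))

/-- The coordinate norm is not submultiplicative in general; in finite dimension it is so up to a
constant, which is enough here. -/
theorem norm_mul_le_cliffMul {n : ℕ} (a b : Cl n) : ‖a * b‖ ≤ ‖cliffMul n‖ * ‖a‖ * ‖b‖ :=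
  (cliffMul n).le_opNorm₂ a b

theorem vec_mul_self_of_mem {n : ℕ} {I : EuclideanSpace ℝ (Fin n)} (hI : I ∈ imagSphere n) :
    vec I * vec I = -1 := by
  have h : ‖I‖ = 1 := hI
  rw [vec_mul_self, h]
  simp

/-- The embedding of `ℂ` into `ℝ_n` with image `ℝ + I ℝ`. -/
def sliceHom {n : ℕ} (I : EuclideanSpace ℝ (Fin n)) (hI : I ∈ imagSphere n) : ℂ →ₐ[ℝ] Cl n :=
  Complex.lift ⟨vec I, vec_mul_self_of_mem hI⟩

theorem sliceHom_apply {n : ℕ} {I : EuclideanSpace ℝ (Fin n)} (hI : I ∈ imagSphere n) (z : ℂ) :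
    sliceHom I hI z = algebraMap ℝ (Cl n) z.re + z.im • vec I := rfl

/-- Left multiplication by the elements of the slice `ℝ + I ℝ`. -/
def sliceMul {n : ℕ} (I : EuclideanSpace ℝ (Fin n)) (hI : I ∈ imagSphere n) :
    ℂ →L[ℝ] Cl n →L[ℝ] Cl n :=
  (cliffMul n).comp (LinearMap.toContinuousLinearMap (sliceHom I hI).toLinearMap)

theorem sliceMul_apply {n : ℕ} {I : EuclideanSpace ℝ (Fin n)} (hI : I ∈ imagSphere n) (z : ℂ)
    (a : Cl n) : sliceMul I hI z a = sliceHom I hI z * a := rfl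

theorem sliceMul_eq {n : ℕ} {I : EuclideanSpace ℝ (Fin n)} (hI : I ∈ imagSphere n) (z : ℂ)
    (a : Cl n) : sliceMul I hI z a = z.re • a + vec I * (z.im • a) := by
  rw [sliceMul_apply, sliceHom_apply, add_mul, ← Algebra.smul_def, smul_mul_assoc, mul_smul_comm]

theorem sliceMul_mul {n : ℕ} {I : EuclideanSpace ℝ (Fin n)} (hI : I ∈ imagSphere n) (z w : ℂ)
    (a : Cl n) : sliceMul I hI (z * w) a = sliceMul I hI z (sliceMul I hI w a) := by
  simp only [sliceMul_apply, map_mul, mul_assoc]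

theorem imagExp_mul {n : ℕ} {I : EuclideanSpace ℝ (Fin n)} (hI : I ∈ imagSphere n) (θ : ℝ)
    (a : Cl n) : imagExp I θ * a = sliceMul I hI (Complex.exp (θ * Complex.I)) a := by
  rw [sliceMul_apply, sliceHom_apply, Complex.exp_ofReal_mul_I_re, Complex.exp_ofReal_mul_I_im,
    imagExp]

/-! ### The Poisson kernel -/

theorem poissonKernel_nonneg {u : ℝ} (hu : 0 < u) (t : ℝ) : 0 ≤ poissonKernel u t := by
  unfold poissonKernel; positivity

theorem continuous_poissonKernel {u : ℝ} (hu : 0 < u) : Continuous (poissonKernel u) := by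
  unfold poissonKernel
  refine Continuous.div (by fun_prop) (by fun_prop) fun t => ?_
  positivity

/-- Uses `w² ≤ 2v² + 2(v - w)²`, then absorbs `1 + 2M²` into a multiple of `u² ≥ δ²`. -/
theorem one_add_sq_le_mul {δ M u v : ℝ} (hδ : 0 < δ) (hu : δ ≤ u) (hv : |v| ≤ M) (w : ℝ) :
    1 + w ^ 2 ≤ (2 + (1 + 2 * M ^ 2) / δ ^ 2) * (u ^ 2 + (v - w) ^ 2) := by
  have h1 : v ^ 2 ≤ M ^ 2 := sq_le_sq' (by linarith [(abs_le.1 hv).1]) (abs_le.1 hv).2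
  have h2 : δ ^ 2 ≤ u ^ 2 := by gcongr
  have h3 : 1 + 2 * M ^ 2 = (1 + 2 * M ^ 2) / δ ^ 2 * δ ^ 2 := by field_simp
  have h4 : 0 ≤ (1 + 2 * M ^ 2) / δ ^ 2 := by positivity
  nlinarith [sq_nonneg (2 * v - w), mul_le_mul_of_nonneg_left h2 h4,
    mul_nonneg h4 (sq_nonneg (v - w)), sq_nonneg u]

theorem inv_sq_add_sq_le {δ M u v : ℝ} (hδ : 0 < δ) (hu : δ ≤ u) (hv : |v| ≤ M) (w : ℝ) :
    (u ^ 2 + (v - w) ^ 2)⁻¹ ≤ (2 + (1 + 2 * M ^ 2) / δ ^ 2) * (1 + w ^ 2)⁻¹ := by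
  have hu0 : 0 < u := hδ.trans_le hu
  rw [← div_eq_mul_inv, le_div_iff₀ (by positivity), inv_mul_le_iff₀ (by positivity), mul_comm]
  exact one_add_sq_le_mul hδ hu hv w

theorem integral_poissonKernel {u : ℝ} (hu : 0 < u) : ∫ t, poissonKernel u t = 1 := by
  have h : ∀ t, poissonKernel u t = (Real.pi⁻¹ * u⁻¹) * (1 + (u⁻¹ * t) ^ 2)⁻¹ := by
    intro t; unfold poissonKernel; field_simp
  simp_rw [h]
  rw [integral_const_mul, Measure.integral_comp_mul_left (fun t => (1 + t ^ 2)⁻¹),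
    integral_univ_inv_one_add_sq]
  rw [inv_inv, abs_of_pos hu, smul_eq_mul]
  field_simp

theorem integrable_poissonKernel {u : ℝ} (hu : 0 < u) : Integrable (poissonKernel u) := by
  refine Integrable.of_integral_ne_zero ?_
  rw [integral_poissonKernel hu]; exact one_ne_zero

/-! ### Weighted integrability of `L^p` functions -/

section Weighted

variable {E : Type*} [NormedAddCommGroup E] [NormedSpace ℝ E]

/-- This weighted integrability is all that the differentiability argument needs from `g ∈ L^p`. The
integrand is dominated by `‖g‖^p + (1 + w²)⁻¹`: the second term serves where `‖g‖ ≤ 1`, the first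
where `‖g‖ ≥ 1`. -/
theorem integrable_inv_one_add_sq_smul {p : ℝ} (hp : 1 ≤ p) {g : ℝ → E}
    (hg : MemLp g (ENNReal.ofReal p) volume) :
    Integrable fun w => (1 + w ^ 2)⁻¹ • g w := by
  have h1 := hg.integrable_norm_rpow (by simpa using by linarith) ENNReal.ofReal_ne_top
  rw [ENNReal.toReal_ofReal (by linarith)] at h1
  refine (h1.add integrable_inv_one_add_sq).mono' ?_ (Eventually.of_forall fun w => ?_)
  · refine Continuous.aestronglyMeasurable ?_ |>.smul hg.1
    exact Continuous.inv₀ (by fun_prop) fun w => by positivity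
  · rw [norm_smul, Real.norm_of_nonneg (by positivity), Pi.add_apply]
    have h2 : (1 + w ^ 2)⁻¹ ≤ 1 := inv_le_one_of_one_le₀ (by nlinarith [sq_nonneg w])
    have h0 : 0 ≤ (1 + w ^ 2)⁻¹ := by positivity
    have h4 : 0 ≤ ‖g w‖ ^ p := by positivity
    rcases le_total ‖g w‖ 1 with h | h
    · nlinarith
    · have h3 : ‖g w‖ ≤ ‖g w‖ ^ p := Real.self_le_rpow_of_one_le h hp
      nlinarith [norm_nonneg (g w)]

end Weighted

/-! ### Differentiability of the Poisson integral -/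

/-- The derivative of the Poisson kernel in `u`. -/
def poissonKernelDu (u t : ℝ) : ℝ := (t ^ 2 - u ^ 2) / (Real.pi * (u ^ 2 + t ^ 2) ^ 2)

/-- The derivative of the Poisson kernel in `t`. -/
def poissonKernelDt (u t : ℝ) : ℝ := -(2 * u * t) / (Real.pi * (u ^ 2 + t ^ 2) ^ 2)

/-- Serves both partial derivatives of the kernel with `r = u² + t²`, since `|t² - u²|` and `|2ut|`
are at most `r`. -/
theorem abs_div_pi_mul_sq_le {x r : ℝ} (hr : 0 < r) (hx : |x| ≤ r) :
    |x / (Real.pi * r ^ 2)| ≤ r⁻¹ := by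
  rw [abs_div, abs_of_pos (by positivity : 0 < Real.pi * r ^ 2), div_le_iff₀ (by positivity)]
  have h : r⁻¹ * (Real.pi * r ^ 2) = Real.pi * r := by field_simp
  rw [h]
  nlinarith [Real.pi_gt_three]

theorem abs_poissonKernelDu_le {u : ℝ} (hu : 0 < u) (t : ℝ) :
    |poissonKernelDu u t| ≤ (u ^ 2 + t ^ 2)⁻¹ :=
  abs_div_pi_mul_sq_le (by positivity)
    (abs_le.2 ⟨by nlinarith [sq_nonneg t], by nlinarith [sq_nonneg u]⟩)

theorem abs_poissonKernelDt_le {u : ℝ} (hu : 0 < u) (t : ℝ) :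
    |poissonKernelDt u t| ≤ (u ^ 2 + t ^ 2)⁻¹ :=
  abs_div_pi_mul_sq_le (by positivity)
    (abs_le.2 ⟨by nlinarith [sq_nonneg (u - t)], by nlinarith [sq_nonneg (u + t)]⟩)

theorem abs_poissonKernel_le {u : ℝ} (hu : 0 < u) (t : ℝ) :
    |poissonKernel u t| ≤ u * (u ^ 2 + t ^ 2)⁻¹ := by
  rw [abs_of_nonneg (poissonKernel_nonneg hu t), poissonKernel, div_eq_mul_inv, mul_inv]
  have h : Real.pi⁻¹ ≤ 1 := inv_le_one_of_one_le₀ (by linarith [Real.pi_gt_three])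
  have h2 : 0 ≤ u * (u ^ 2 + t ^ 2)⁻¹ := by positivity
  nlinarith

theorem continuous_poissonKernelDu {u : ℝ} (hu : 0 < u) : Continuous (poissonKernelDu u) := by
  unfold poissonKernelDu
  exact Continuous.div (by fun_prop) (by fun_prop) fun t => by positivity

theorem continuous_poissonKernelDt {u : ℝ} (hu : 0 < u) : Continuous (poissonKernelDt u) := by
  unfold poissonKernelDt
  exact Continuous.div (by fun_prop) (by fun_prop) fun t => by positivity

theorem hasFDerivAt_poissonKernel {x : ℝ × ℝ} (hx : 0 < x.1) (w : ℝ) :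
    HasFDerivAt (fun y : ℝ × ℝ => poissonKernel y.1 (y.2 - w))
      (poissonKernelDu x.1 (x.2 - w) • ContinuousLinearMap.fst ℝ ℝ ℝ +
        poissonKernelDt x.1 (x.2 - w) • ContinuousLinearMap.snd ℝ ℝ ℝ) x := by
  have h1 : HasFDerivAt (fun y : ℝ × ℝ => y.1) (ContinuousLinearMap.fst ℝ ℝ ℝ) x := hasFDerivAt_fst
  have h2 : HasFDerivAt (fun y : ℝ × ℝ => y.2 - w) (ContinuousLinearMap.snd ℝ ℝ ℝ) x :=
    hasFDerivAt_snd.sub_const w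
  have h3 : HasFDerivAt (fun y : ℝ × ℝ => Real.pi * (y.1 ^ 2 + (y.2 - w) ^ 2))
      (Real.pi • ((2 * x.1) • ContinuousLinearMap.fst ℝ ℝ ℝ +
        (2 * (x.2 - w)) • ContinuousLinearMap.snd ℝ ℝ ℝ)) x := by
    have := ((h1.pow 2).add (h2.pow 2)).const_mul Real.pi
    convert! this using 1
    ext <;> simp
  have hd : Real.pi * (x.1 ^ 2 + (x.2 - w) ^ 2) ≠ 0 := by positivity
  have hq : x.1 ^ 2 + (x.2 - w) ^ 2 ≠ 0 := by positivity
  have h4 := h1.mul ((hasDerivAt_inv hd).comp_hasFDerivAt x h3)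
  convert! h4 using 1
  ext <;> simp [poissonKernelDu, poissonKernelDt] <;> field_simp
  ring

section

variable {E : Type*} [NormedAddCommGroup E] [NormedSpace ℝ E] {g : ℝ → E}

theorem integrable_smul_of_le (hw : Integrable fun w => (1 + w ^ 2)⁻¹ • g w) {k : ℝ → ℝ}
    (hk : Continuous k) {C : ℝ} (hC : ∀ w, |k w| ≤ C * (1 + w ^ 2)⁻¹) :
    Integrable fun w => k w • g w := by
  have h1 : (fun w => k w • g w) = fun w => (k w * (1 + w ^ 2)) • ((1 + w ^ 2)⁻¹ • g w) := by
    funext w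
    rw [smul_smul, mul_assoc, mul_inv_cancel₀ (by positivity), mul_one]
  have h2 : Continuous fun w => k w * (1 + w ^ 2) := by fun_prop
  rw [h1]
  refine hw.bdd_smul C h2.aestronglyMeasurable (Eventually.of_forall fun w => ?_)
  rw [Real.norm_eq_abs, abs_mul, abs_of_pos (by positivity : 0 < 1 + w ^ 2),
    ← le_div_iff₀ (by positivity), div_eq_mul_inv]
  exact hC w

theorem integrable_kernel_smul (hw : Integrable fun w => (1 + w ^ 2)⁻¹ • g w) {k : ℝ → ℝ}
    (hk : Continuous k) {u : ℝ} (hu : 0 < u) {C : ℝ} (hC : 0 ≤ C)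
    (hkC : ∀ t, |k t| ≤ C * (u ^ 2 + t ^ 2)⁻¹) (v : ℝ) :
    Integrable fun w => k (v - w) • g w := by
  refine integrable_smul_of_le hw (k := fun w => k (v - w)) (by fun_prop)
    (C := C * (2 + (1 + 2 * |v| ^ 2) / u ^ 2)) fun w => (hkC _).trans ?_
  rw [mul_assoc]
  exact mul_le_mul_of_nonneg_left (inv_sq_add_sq_le hu le_rfl le_rfl w) hC

theorem integrable_poissonKernel_smul (hw : Integrable fun w => (1 + w ^ 2)⁻¹ • g w) {u : ℝ}
    (hu : 0 < u) (v : ℝ) : Integrable fun w => poissonKernel u (v - w) • g w :=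
  integrable_kernel_smul hw (continuous_poissonKernel hu) hu hu.le (abs_poissonKernel_le hu) v

theorem integrable_poissonKernelDu_smul (hw : Integrable fun w => (1 + w ^ 2)⁻¹ • g w) {u : ℝ}
    (hu : 0 < u) (v : ℝ) : Integrable fun w => poissonKernelDu u (v - w) • g w :=
  integrable_kernel_smul hw (continuous_poissonKernelDu hu) hu zero_le_one
    (fun t => (abs_poissonKernelDu_le hu t).trans_eq (one_mul _).symm) v

theorem integrable_poissonKernelDt_smul (hw : Integrable fun w => (1 + w ^ 2)⁻¹ • g w) {u : ℝ}
    (hu : 0 < u) (v : ℝ) : Integrable fun w => poissonKernelDt u (v - w) • g w :=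
  integrable_kernel_smul hw (continuous_poissonKernelDt hu) hu zero_le_one
    (fun t => (abs_poissonKernelDt_le hu t).trans_eq (one_mul _).symm) v

/-- The `u`-derivative of the Poisson integral. -/
def poissonIntegralDu (g : ℝ → E) (u v : ℝ) : E := ∫ w : ℝ, poissonKernelDu u (v - w) • g w

/-- The `v`-derivative of the Poisson integral. -/
def poissonIntegralDv (g : ℝ → E) (u v : ℝ) : E := ∫ w : ℝ, poissonKernelDt u (v - w) • g w

/-- The linear map `(h, k) ↦ h • a + k • b`. -/
def pairSmul (a b : E) : ℝ × ℝ →L[ℝ] E :=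
  (ContinuousLinearMap.fst ℝ ℝ ℝ).smulRight a + (ContinuousLinearMap.snd ℝ ℝ ℝ).smulRight b

@[simp] theorem pairSmul_apply (a b : E) (x : ℝ × ℝ) : pairSmul a b x = x.1 • a + x.2 • b := rfl

theorem norm_pairSmul_le (a b : E) : ‖pairSmul a b‖ ≤ ‖a‖ + ‖b‖ := by
  refine ContinuousLinearMap.opNorm_le_bound _ (by positivity) fun x => ?_
  rw [pairSmul_apply, add_mul, mul_comm ‖a‖, mul_comm ‖b‖]
  refine (norm_add_le _ _).trans (add_le_add ?_ ?_) <;> rw [norm_smul]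
  · exact mul_le_mul_of_nonneg_right (norm_fst_le x) (norm_nonneg _)
  · exact mul_le_mul_of_nonneg_right (norm_snd_le x) (norm_nonneg _)

theorem integrable_pairSmul {a b : ℝ → E} (ha : Integrable a) (hb : Integrable b) :
    Integrable fun w => pairSmul (a w) (b w) :=
  ((ContinuousLinearMap.smulRightL ℝ (ℝ × ℝ) E
    (ContinuousLinearMap.fst ℝ ℝ ℝ)).integrable_comp ha).add
    ((ContinuousLinearMap.smulRightL ℝ (ℝ × ℝ) E
      (ContinuousLinearMap.snd ℝ ℝ ℝ)).integrable_comp hb)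

theorem integral_pairSmul [CompleteSpace E] {a b : ℝ → E} (ha : Integrable a)
    (hb : Integrable b) :
    ∫ w, pairSmul (a w) (b w) = pairSmul (∫ w, a w) (∫ w, b w) := by
  refine ContinuousLinearMap.ext fun x => ?_
  rw [ContinuousLinearMap.integral_apply (integrable_pairSmul ha hb)]
  simp only [pairSmul_apply]
  refine (integral_add (ha.smul x.1) (hb.smul x.2)).trans ?_
  rw [← integral_smul, ← integral_smul]
  rfl

theorem norm_kernel_smul_le {δ M u v c : ℝ} (hδ : 0 < δ) (hu : δ ≤ u) (hv : |v| ≤ M) (w : ℝ)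
    (hc : |c| ≤ (u ^ 2 + (v - w) ^ 2)⁻¹) (a : E) :
    ‖c • a‖ ≤ (2 + (1 + 2 * M ^ 2) / δ ^ 2) * ‖(1 + w ^ 2)⁻¹ • a‖ := by
  rw [norm_smul, norm_smul, ← mul_assoc, Real.norm_eq_abs,
    Real.norm_of_nonneg (by positivity : 0 ≤ (1 + w ^ 2)⁻¹)]
  exact mul_le_mul_of_nonneg_right (hc.trans (inv_sq_add_sq_le hδ hu hv w)) (norm_nonneg _)

/-- Radius `u / 2` keeps the first coordinate away from `0`, so one integrable majorant serves the
whole ball. -/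
theorem bounds_of_mem_ball {u v : ℝ} {x : ℝ × ℝ} (hx : x ∈ Metric.ball (u, v) (u / 2)) :
    u / 2 ≤ x.1 ∧ |x.2| ≤ |v| + u / 2 := by
  rw [← ball_prod_same, Set.mem_prod, Metric.mem_ball, Metric.mem_ball, Real.dist_eq,
    Real.dist_eq] at hx
  obtain ⟨h1, h2⟩ := hx
  have := abs_sub_abs_le_abs_sub x.2 v
  exact ⟨by linarith [(abs_lt.1 h1).1], by linarith⟩

theorem hasFDerivAt_poissonKernel_smul {x : ℝ × ℝ} (hx : 0 < x.1) (w : ℝ) (a : E) :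
    HasFDerivAt (fun y : ℝ × ℝ => poissonKernel y.1 (y.2 - w) • a)
      (pairSmul (poissonKernelDu x.1 (x.2 - w) • a) (poissonKernelDt x.1 (x.2 - w) • a)) x := by
  refine ((hasFDerivAt_poissonKernel hx w).smul_const a).congr_fderiv ?_
  refine ContinuousLinearMap.ext fun y => ?_
  simp [add_smul, smul_smul, mul_comm]

theorem hasFDerivAt_integral_poissonKernel_smul [CompleteSpace E]
    (hw : Integrable fun w => (1 + w ^ 2)⁻¹ • g w) {x : ℝ × ℝ} (hx : 0 < x.1) :
    HasFDerivAt (fun x : ℝ × ℝ => ∫ w, poissonKernel x.1 (x.2 - w) • g w)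
      (pairSmul (poissonIntegralDu g x.1 x.2) (poissonIntegralDv g x.1 x.2)) x := by
  have iu := integrable_poissonKernelDu_smul hw hx x.2
  have it := integrable_poissonKernelDt_smul hw hx x.2
  rw [poissonIntegralDu, poissonIntegralDv, ← integral_pairSmul iu it]
  have hu2 : 0 < x.1 / 2 := half_pos hx
  -- The constant of `inv_sq_add_sq_le` for `δ = u/2`, `M = |v| + u/2`; the factor 2 in the bound
  -- below counts the two partial derivatives.
  obtain ⟨C, hC⟩ : ∃ C, C = 2 + (1 + 2 * (|x.2| + x.1 / 2) ^ 2) / (x.1 / 2) ^ 2 := ⟨_, rfl⟩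
  refine hasFDerivAt_integral_of_dominated_of_fderiv_le
    (F := fun (x : ℝ × ℝ) w => poissonKernel x.1 (x.2 - w) • g w)
    (F' := fun (x : ℝ × ℝ) w => pairSmul (poissonKernelDu x.1 (x.2 - w) • g w)
      (poissonKernelDt x.1 (x.2 - w) • g w))
    (bound := fun w => 2 * (C * ‖(1 + w ^ 2)⁻¹ • g w‖))
    (Metric.ball_mem_nhds _ hu2) ?_ (integrable_poissonKernel_smul hw hx x.2)
    (integrable_pairSmul iu it).1 ?_ ((hw.norm.const_mul C).const_mul 2) ?_
  · filter_upwards [Metric.ball_mem_nhds x hu2] with y hy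
    exact (integrable_poissonKernel_smul hw (hu2.trans_le (bounds_of_mem_ball hy).1) y.2).1
  · refine Eventually.of_forall fun w y hy => ?_
    obtain ⟨h1, h2⟩ := bounds_of_mem_ball hy
    have hy0 : 0 < y.1 := hu2.trans_le h1
    rw [two_mul, hC]
    exact (norm_pairSmul_le _ _).trans (add_le_add
      (norm_kernel_smul_le hu2 h1 h2 w (abs_poissonKernelDu_le hy0 _) _)
      (norm_kernel_smul_le hu2 h1 h2 w (abs_poissonKernelDt_le hy0 _) _))
  · exact Eventually.of_forall fun w y hy =>
      hasFDerivAt_poissonKernel_smul (hu2.trans_le (bounds_of_mem_ball hy).1) w (g w)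

theorem hasDerivAt_integral_poissonKernel_smul_snd [CompleteSpace E]
    (hw : Integrable fun w => (1 + w ^ 2)⁻¹ • g w) {u : ℝ} (hu : 0 < u) (v : ℝ) :
    HasDerivAt (fun t => ∫ w, poissonKernel u (t - w) • g w) (poissonIntegralDv g u v) v := by
  have h := (hasFDerivAt_integral_poissonKernel_smul (x := (u, v)) hw hu).comp_hasDerivAt v
    ((hasDerivAt_const v u).prodMk (hasDerivAt_id v))
  simpa using! h

end

section

variable {n : ℕ} {g : ℝ → Cl n}

theorem hasFDerivAt_poissonIntegral (hw : Integrable fun w => (1 + w ^ 2)⁻¹ • g w) {u : ℝ}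
    (hu : 0 < u) (v : ℝ) :
    HasFDerivAt (fun x : ℝ × ℝ => poissonIntegral g x.1 x.2)
      (pairSmul (poissonIntegralDu g u v) (poissonIntegralDv g u v)) (u, v) :=
  hasFDerivAt_integral_poissonKernel_smul (x := (u, v)) hw hu

theorem hasDerivAt_poissonIntegral_snd (hw : Integrable fun w => (1 + w ^ 2)⁻¹ • g w) {u : ℝ}
    (hu : 0 < u) (v : ℝ) :
    HasDerivAt (fun t => poissonIntegral g u t) (poissonIntegralDv g u v) v :=
  hasDerivAt_integral_poissonKernel_smul_snd hw hu v

end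

/-! ### The Cauchy-Riemann equation from the support condition -/

theorem norm_ofReal_mul_exp_neg_mul (z : ℂ) {s : ℝ} (hs : 0 ≤ s) :
    ‖(s : ℂ) * Complex.exp (-(z * s))‖ = s * Real.exp (-(z.re * s)) := by
  rw [norm_mul, Complex.norm_real, Real.norm_of_nonneg hs, Complex.norm_exp]
  simp

theorem memLp_ofReal_mul_exp_neg_mul {z : ℂ} (hz : 0 < z.re) {p : ℝ} (hp : 1 ≤ p) :
    MemLp (fun s : ℝ => (s : ℂ) * Complex.exp (-(z * s))) (ENNReal.ofReal p)
      (volume.restrict (Set.Ioi 0)) := by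
  have hc : Continuous fun s : ℝ => (s : ℂ) * Complex.exp (-(z * s)) := by fun_prop
  have hp0 : 0 < p := by linarith
  rw [← integrable_norm_rpow_iff hc.aestronglyMeasurable (by simpa using hp0)
    ENNReal.ofReal_ne_top, ENNReal.toReal_ofReal hp0.le]
  have h := integrableOn_rpow_mul_exp_neg_mul_rpow (s := p) (p := 1) (b := p * z.re) (by linarith)
    one_pos (by positivity)
  refine h.congr_fun (fun s hs => ?_) measurableSet_Ioi
  have hs0 : (0 : ℝ) < s := hs
  simp only [norm_ofReal_mul_exp_neg_mul z hs0.le, Real.rpow_one]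
  rw [Real.mul_rpow hs0.le (Real.exp_pos _).le, ← Real.exp_mul]
  ring_nf

theorem integrableOn_ofReal_mul_exp_neg_mul {z : ℂ} (hz : 0 < z.re) :
    IntegrableOn (fun s : ℝ => (s : ℂ) * Complex.exp (-(z * s))) (Set.Ioi 0) := by
  have h := memLp_ofReal_mul_exp_neg_mul hz le_rfl
  rwa [ENNReal.ofReal_one, memLp_one_iff_integrable] at h

/-- An antiderivative is `-(s/z + 1/z²) e^{-zs}`, which tends to `0` at infinity because `Re z > 0`.
-/
theorem integral_ofReal_mul_exp_neg_mul_Ioi {z : ℂ} (hz : 0 < z.re) :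
    ∫ s : ℝ in Set.Ioi 0, (s : ℂ) * Complex.exp (-(z * s)) = (z ^ 2)⁻¹ := by
  have hz0 : z ≠ 0 := by rintro rfl; simp at hz
  have hd : ∀ s ∈ Set.Ici (0 : ℝ), HasDerivAt
      (fun s : ℝ => -(z⁻¹ * s + (z ^ 2)⁻¹) * Complex.exp (-(z * s)))
      ((s : ℂ) * Complex.exp (-(z * s))) s := by
    intro s _
    have h1 : HasDerivAt (fun s : ℝ => (s : ℂ)) 1 s := Complex.ofRealCLM.hasDerivAt
    have h2 : HasDerivAt (fun s : ℝ => Complex.exp (-(z * s)))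
        (Complex.exp (-(z * s)) * (-(z * 1))) s := (h1.const_mul z).neg.cexp
    have h3 : HasDerivAt (fun s : ℝ => -(z⁻¹ * s + (z ^ 2)⁻¹)) (-(z⁻¹ * 1)) s :=
      ((h1.const_mul z⁻¹).add_const ((z ^ 2)⁻¹)).neg
    convert! h3.mul h2 using 1
    field_simp
    ring
  have hlim : Tendsto (fun s : ℝ => -(z⁻¹ * s + (z ^ 2)⁻¹) * Complex.exp (-(z * s))) atTop
      (𝓝 0) := by
    have h1 : Tendsto (fun s : ℝ => s ^ 1 * Real.exp (-(z.re) * s)) atTop (𝓝 0) := by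
      simpa using tendsto_rpow_mul_exp_neg_mul_atTop_nhds_zero 1 z.re hz
    have h0 : Tendsto (fun s : ℝ => Real.exp (-(z.re) * s)) atTop (𝓝 0) := by
      simpa using tendsto_rpow_mul_exp_neg_mul_atTop_nhds_zero 0 z.re hz
    have h2 := (h1.const_mul ‖z⁻¹‖).add (h0.const_mul ‖(z ^ 2)⁻¹‖)
    simp only [mul_zero, add_zero] at h2
    refine squeeze_zero_norm' ?_ h2
    filter_upwards [eventually_ge_atTop 0] with s hs
    rw [norm_mul, norm_neg, Complex.norm_exp, ← mul_assoc, ← add_mul]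
    have h3 : (-(z * (s : ℂ))).re = -z.re * s := by simp
    rw [h3]
    refine mul_le_mul_of_nonneg_right ((norm_add_le _ _).trans ?_) (Real.exp_pos _).le
    rw [norm_mul, Complex.norm_real, Real.norm_of_nonneg hs, pow_one]
  rw [integral_Ioi_of_hasDerivAt_of_tendsto' hd (integrableOn_ofReal_mul_exp_neg_mul hz) hlim]
  simp

section

variable {n : ℕ} {I : EuclideanSpace ℝ (Fin n)}

theorem cliffFourier_eq (hI : I ∈ imagSphere n) (h : ℝ → Cl n) (s : ℝ) :
    cliffFourier I h s = (Real.sqrt (2 * Real.pi))⁻¹ •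
      ∫ x : ℝ, sliceMul I hI (Complex.exp ((-(x * s) : ℝ) * Complex.I)) (h x) := by
  simp only [cliffFourier, imagExp_mul hI]

theorem norm_sliceMul_le (hI : I ∈ imagSphere n) (z : ℂ) (a : Cl n) :
    ‖sliceMul I hI z a‖ ≤ ‖sliceMul I hI‖ * ‖z‖ * ‖a‖ :=
  (sliceMul I hI).le_opNorm₂ z a

/-- Supplies the measurability needed for Hölder's inequality. -/
theorem continuous_cliffFourier (hI : I ∈ imagSphere n) {h : ℝ → Cl n} (hh : Integrable h) :
    Continuous (cliffFourier I h) := by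
  have h1 : Continuous fun s : ℝ =>
      ∫ x : ℝ, sliceMul I hI (Complex.exp ((-(x * s) : ℝ) * Complex.I)) (h x) := by
    refine continuous_of_dominated (bound := fun x => ‖sliceMul I hI‖ * ‖h x‖) (fun s => ?_)
      (fun s => Eventually.of_forall fun x => ?_) (hh.norm.const_mul _)
      (Eventually.of_forall fun x => ?_)
    · exact (sliceMul I hI).aestronglyMeasurable_comp₂
        (Continuous.aestronglyMeasurable (by fun_prop)) hh.1
    · refine (norm_sliceMul_le hI _ _).trans_eq ?_
      rw [Complex.norm_exp_ofReal_mul_I, mul_one]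
    · exact ((sliceMul I hI).continuous.comp (by fun_prop)).clm_apply continuous_const
  have h2 : cliffFourier I h = fun s => (Real.sqrt (2 * Real.pi))⁻¹ •
      ∫ x : ℝ, sliceMul I hI (Complex.exp ((-(x * s) : ℝ) * Complex.I)) (h x) :=
    funext fun s => cliffFourier_eq hI h s
  rw [h2]
  exact h1.const_smul ((Real.sqrt (2 * Real.pi))⁻¹ : ℝ)

theorem integrable_sliceMul_exp (hI : I ∈ imagSphere n) {h : ℝ → Cl n} (hh : Integrable h) (s : ℝ) :
    Integrable fun x : ℝ => sliceMul I hI (Complex.exp ((-(x * s) : ℝ) * Complex.I)) (h x) := by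
  refine (hh.norm.const_mul ‖sliceMul I hI‖).mono' ?_ (Eventually.of_forall fun x => ?_)
  · exact (sliceMul I hI).aestronglyMeasurable_comp₂
      (Continuous.aestronglyMeasurable (by fun_prop)) hh.1
  · refine (norm_sliceMul_le hI _ _).trans_eq ?_
    rw [Complex.norm_exp_ofReal_mul_I, mul_one]

/-- Fubini: `s e^{-zs}` and `e^{-Ixs}` both act through the same copy of `ℂ`, so they merge into `s
e^{-(z + Ix)s}`, whose `s`-integral is the Laplace transform above. -/
theorem integral_sliceMul_cliffFourier (hI : I ∈ imagSphere n) {h : ℝ → Cl n}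
    (hh : Integrable h) {z : ℂ}    (hz : 0 < z.re) :
    ∫ s : ℝ in Set.Ioi 0, sliceMul I hI ((s : ℂ) * Complex.exp (-(z * s))) (cliffFourier I h s) =
      (Real.sqrt (2 * Real.pi))⁻¹ •
        ∫ x : ℝ, sliceMul I hI (((z + x * Complex.I) ^ 2)⁻¹) (h x) := by
  set k : ℝ → ℂ := fun s => (s : ℂ) * Complex.exp (-(z * s)) with hk
  have hkc : Continuous k := by fun_prop
  have hint : Integrable (Function.uncurry fun (s x : ℝ) =>
      sliceMul I hI (k s * Complex.exp ((-(x * s) : ℝ) * Complex.I)) (h x))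
      ((volume.restrict (Set.Ioi 0)).prod volume) := by
    have hb := ((integrableOn_ofReal_mul_exp_neg_mul hz).norm.mul_prod hh.norm).const_mul
      ‖sliceMul I hI‖
    refine hb.mono' ?_ (Eventually.of_forall fun y => ?_)
    · refine (sliceMul I hI).aestronglyMeasurable_comp₂
        (f := fun y : ℝ × ℝ => k y.1 * Complex.exp ((-(y.2 * y.1) : ℝ) * Complex.I))
        (g := fun y : ℝ × ℝ => h y.2)
        (Continuous.aestronglyMeasurable (by fun_prop)) hh.1.comp_snd
    · refine (norm_sliceMul_le hI _ _).trans_eq ?_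
      rw [norm_mul, Complex.norm_exp_ofReal_mul_I, mul_one, mul_assoc]
  have h1 : ∀ s, sliceMul I hI (k s) (cliffFourier I h s) = (Real.sqrt (2 * Real.pi))⁻¹ •
      ∫ x : ℝ, sliceMul I hI (k s * Complex.exp ((-(x * s) : ℝ) * Complex.I)) (h x) := by
    intro s
    rw [cliffFourier_eq hI, map_smul,
      ← (sliceMul I hI (k s)).integral_comp_comm (integrable_sliceMul_exp hI hh s)]
    simp only [sliceMul_mul]
  refine (integral_congr_ae (Eventually.of_forall h1)).trans ?_
  rw [integral_smul, integral_integral_swap hint]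
  congr 1
  refine integral_congr_ae (Eventually.of_forall fun x => ?_)
  have hzx : 0 < (z + x * Complex.I).re := by simpa using hz
  have h2 : ∀ s : ℝ, k s * Complex.exp ((-(x * s) : ℝ) * Complex.I) =
      (s : ℂ) * Complex.exp (-((z + x * Complex.I) * s)) := by
    intro s
    rw [hk, mul_assoc, ← Complex.exp_add]
    congr 2
    push_cast
    ring
  simp only [h2]
  have h3 := integrableOn_ofReal_mul_exp_neg_mul hzx
  have h4 := ((sliceMul I hI).flip (h x)).integral_comp_comm h3
  simp only [ContinuousLinearMap.flip_apply] at h4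
  rw [h4, integral_ofReal_mul_exp_neg_mul_Ioi hzx]

theorem integrable_sliceMul (hI : I ∈ imagSphere n) {g : ℝ → Cl n}
    (hw : Integrable fun w => (1 + w ^ 2)⁻¹ • g w) {k : ℝ → ℂ}
    (hk : Continuous k) {C : ℝ} (hC : ∀ w, ‖k w‖ ≤ C * (1 + w ^ 2)⁻¹) :
    Integrable fun w => sliceMul I hI (k w) (g w) := by
  have h1 := integrable_smul_of_le hw (Complex.continuous_re.comp hk)
    fun w => (Complex.abs_re_le_norm (k w)).trans (hC w)
  have h2 := integrable_smul_of_le hw (Complex.continuous_im.comp hk)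
    fun w => (Complex.abs_im_le_norm (k w)).trans (hC w)
  have h3 := h1.add ((cliffMul n (vec I)).integrable_comp h2)
  refine h3.congr (Eventually.of_forall fun w => ?_)
  exact (sliceMul_eq hI _ _).symm

theorem norm_add_mul_I_sq_inv (z : ℂ) (w : ℝ) :
    ‖((z + w * Complex.I) ^ 2)⁻¹‖ = (z.re ^ 2 + (-z.im - w) ^ 2)⁻¹ := by
  rw [norm_inv, norm_pow, Complex.sq_norm, Complex.normSq_apply]
  simp
  ring

theorem integrable_sliceMul_inv_sq (hI : I ∈ imagSphere n) {g : ℝ → Cl n}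
    (hw : Integrable fun w => (1 + w ^ 2)⁻¹ • g w) {z : ℂ} (hz : 0 < z.re) :
    Integrable fun w : ℝ => sliceMul I hI (((z + w * Complex.I) ^ 2)⁻¹) (g w) := by
  have hne : ∀ w : ℝ, (z + w * Complex.I) ^ 2 ≠ 0 := by
    intro w h0
    have h1 := congrArg Complex.re (pow_eq_zero_iff two_ne_zero |>.1 h0)
    simp at h1
    exact hz.ne' h1
  refine integrable_sliceMul hI hw (k := fun w => ((z + w * Complex.I) ^ 2)⁻¹)
    (C := 2 + (1 + 2 * |-z.im| ^ 2) / z.re ^ 2) (Continuous.inv₀ (by fun_prop) hne) fun w => ?_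
  rw [norm_add_mul_I_sq_inv]
  exact inv_sq_add_sq_le hz le_rfl le_rfl w

theorem integral_sliceMul_inv_sq_eq_zero (hI : I ∈ imagSphere n) {p : ℝ} (hp : 1 ≤ p)
    {g : ℝ → Cl n} (hg : MemLp g (ENNReal.ofReal p) volume)
    (hsupp : CliffFourierSupportedIn I p g (Set.Iic 0)) {z : ℂ} (hz : 0 < z.re) :
    ∫ w : ℝ, sliceMul I hI (((z + w * Complex.I) ^ 2)⁻¹) (g w) = 0 := by
  obtain ⟨G, ⟨hG, hlim⟩, hG0⟩ := hsupp
  have hp' : 1 ≤ ENNReal.ofReal p := by simpa using hp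
  have hconj := ENNReal.HolderConjugate.conjExponent hp'
  set q := (ENNReal.ofReal p).conjExponent with hq
  set K : ℝ → ℂ := fun w => ((z + w * Complex.I) ^ 2)⁻¹ with hK
  set k : ℝ → ℂ := fun s => (s : ℂ) * Complex.exp (-(z * s)) with hk
  have hw := integrable_inv_one_add_sq_smul hp hg
  have hKint := integrable_sliceMul_inv_sq hI hw hz
  -- The truncated integrals converge to the full one. The rest shows that they also tend to `0`.
  have hT1 := (aecover_Icc (μ := volume) tendsto_neg_atTop_atBot
    tendsto_id).integral_tendsto_of_countably_generated hKint
  have hgR : ∀ R : ℝ, Integrable ((Set.Icc (-R) R).indicator g) := fun R =>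
    (integrable_indicator_iff measurableSet_Icc).2
      ((hg.locallyIntegrable hp').integrableOn_isCompact isCompact_Icc)
  have hpair : ∀ R : ℝ, ∫ w in Set.Icc (-R) R, sliceMul I hI (K w) (g w) =
      Real.sqrt (2 * Real.pi) • ∫ s : ℝ in Set.Ioi 0,
        sliceMul I hI (k s) (cliffFourier I ((Set.Icc (-R) R).indicator g) s) := by
    intro R
    have h := integral_sliceMul_cliffFourier hI (hgR R) hz
    rw [h, smul_smul, mul_inv_cancel₀ (by positivity), one_smul,
      ← integral_indicator measurableSet_Icc]
    refine integral_congr_ae (Eventually.of_forall fun w => ?_)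
    by_cases hw : w ∈ Set.Icc (-R) R
    · simp [hw, hK]
    · simp [hw]
  have hT2 : Tendsto (fun R : ℝ => ∫ s : ℝ in Set.Ioi 0,
      sliceMul I hI (k s) (cliffFourier I ((Set.Icc (-R) R).indicator g) s)) atTop (𝓝 0) := by
    have hbound : ∀ R : ℝ, ‖∫ s : ℝ in Set.Ioi 0,
        sliceMul I hI (k s) (cliffFourier I ((Set.Icc (-R) R).indicator g) s)‖ₑ ≤
        ‖sliceMul I hI‖₊ * eLpNorm k (ENNReal.ofReal p) (volume.restrict (Set.Ioi 0)) *
          eLpNorm (fun w => cliffFourier I ((Set.Icc (-R) R).indicator g) w - G w) q volume := by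
      intro R
      have hm : AEStronglyMeasurable
          (fun w => cliffFourier I ((Set.Icc (-R) R).indicator g) w - G w) volume :=
        (continuous_cliffFourier hI (hgR R)).aestronglyMeasurable.sub hG.1
      -- The support condition enters here: `G` vanishes a.e. on `(0,∞)`, so it may be subtracted
      -- freely.
      have h1 : ∫ s : ℝ in Set.Ioi 0,
          sliceMul I hI (k s) (cliffFourier I ((Set.Icc (-R) R).indicator g) s) =
          ∫ s : ℝ in Set.Ioi 0, sliceMul I hI (k s)
            (cliffFourier I ((Set.Icc (-R) R).indicator g) s - G s) := by
        refine setIntegral_congr_ae measurableSet_Ioi ?_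
        filter_upwards [hG0] with s hs hs0
        rw [hs (by simpa using hs0), sub_zero]
      rw [h1]
      refine (enorm_integral_le_lintegral_enorm _).trans ?_
      rw [← eLpNorm_one_eq_lintegral_enorm]
      -- Hölder with the exponential factor in `L^p` and the Fourier difference in `L^q`; `q = ∞` is
      -- included.
      refine (eLpNorm_le_eLpNorm_mul_eLpNorm_of_nnnorm (p := ENNReal.ofReal p) (q := q)
        (memLp_ofReal_mul_exp_neg_mul hz hp).1 hm.restrict
        (fun a b => sliceMul I hI a b) ‖sliceMul I hI‖₊
        (Eventually.of_forall fun s => (sliceMul I hI).le_opNorm₂ _ _)).trans ?_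
      exact mul_le_mul_right (eLpNorm_mono_measure _ Measure.restrict_le_self) _
    have hC : (‖sliceMul I hI‖₊ : ℝ≥0∞) *
        eLpNorm k (ENNReal.ofReal p) (volume.restrict (Set.Ioi 0)) ≠ ⊤ :=
      ENNReal.mul_ne_top ENNReal.coe_ne_top (memLp_ofReal_mul_exp_neg_mul hz hp).2.ne
    have h0 := ENNReal.Tendsto.const_mul hlim (Or.inr hC)
    rw [mul_zero] at h0
    have h2 := tendsto_of_tendsto_of_tendsto_of_le_of_le tendsto_const_nhds h0
      (fun _ => zero_le) hbound
    rw [tendsto_zero_iff_norm_tendsto_zero]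
    have h3 := (ENNReal.tendsto_toReal ENNReal.zero_ne_top).comp h2
    exact h3.congr fun R => toReal_enorm _
  have hT3 := hT2.const_smul (Real.sqrt (2 * Real.pi))
  rw [smul_zero] at hT3
  exact tendsto_nhds_unique hT1 (hT3.congr fun R => (hpair R).symm)

/-- The kernel is `(2π)⁻¹ [(u + It)⁻¹ + (u - It)⁻¹]`; `∂_u + I∂_t` kills the first term and doubles
the derivative of the second. -/
theorem sliceMul_neg_pi_inv_mul (hI : I ∈ imagSphere n) (u t : ℝ) (hu : 0 < u) (a : Cl n) :
    sliceMul I hI (-(Real.pi : ℂ)⁻¹ * ((u - t * Complex.I) ^ 2)⁻¹) a =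
      poissonKernelDu u t • a + vec I * (poissonKernelDt u t • a) := by
  have h : -(Real.pi : ℂ)⁻¹ * (((u : ℂ) - t * Complex.I) ^ 2)⁻¹ =
      poissonKernelDu u t + poissonKernelDt u t * Complex.I := by
    have h1 : ((u : ℂ) ^ 2 + (t : ℂ) ^ 2) ≠ 0 := by
      have : u ^ 2 + t ^ 2 ≠ 0 := by positivity
      exact_mod_cast this
    have h2 : (u : ℂ) ^ 2 + (t : ℂ) ^ 2 = (u - t * Complex.I) * (u + t * Complex.I) := by
      ring_nf; simp
    have h3 : (u : ℂ) - t * Complex.I ≠ 0 := fun h0 => h1 (by rw [h2, h0, zero_mul])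
    have hpi : (Real.pi : ℂ) ≠ 0 := by exact_mod_cast Real.pi_ne_zero
    simp only [poissonKernelDu, poissonKernelDt]
    push_cast
    rw [← mul_right_inj' (mul_ne_zero hpi (pow_ne_zero 2 h3)), h2]
    have h4 : (u : ℂ) + t * Complex.I ≠ 0 := fun h0 => h1 (by rw [h2, h0, mul_zero])
    field_simp
    ring_nf
    simp only [Complex.I_sq]
    ring
  rw [h, sliceMul_eq]
  simp

theorem poissonIntegral_cauchyRiemann (hI : I ∈ imagSphere n) {p : ℝ} (hp : 1 ≤ p)
    {g : ℝ → Cl n} (hg : MemLp g (ENNReal.ofReal p) volume)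
    (hsupp : CliffFourierSupportedIn I p g (Set.Iic 0)) {u : ℝ} (hu : 0 < u) (v : ℝ) :
    poissonIntegralDu g u v + vec I * poissonIntegralDv g u v = 0 := by
  have hw := integrable_inv_one_add_sq_smul hp hg
  have iu := integrable_poissonKernelDu_smul hw hu v
  have it := integrable_poissonKernelDt_smul hw hu v
  have h0 := integral_sliceMul_inv_sq_eq_zero hI hp hg hsupp (z := u - v * Complex.I)
    (by simpa using hu)
  have h1 : ∀ w : ℝ, sliceMul I hI (-(Real.pi : ℂ)⁻¹)
      (sliceMul I hI (((u - v * Complex.I + w * Complex.I) ^ 2)⁻¹) (g w)) =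
      poissonKernelDu u (v - w) • g w + vec I * (poissonKernelDt u (v - w) • g w) := by
    intro w
    rw [← sliceMul_neg_pi_inv_mul hI u (v - w) hu, ← sliceMul_mul]
    push_cast
    ring_nf
  have hadd : poissonIntegralDu g u v + vec I * poissonIntegralDv g u v =
      ∫ w, (poissonKernelDu u (v - w) • g w + vec I * (poissonKernelDt u (v - w) • g w)) := by
    have h2 := integral_add iu ((cliffMul n (vec I)).integrable_comp it)
    rw [(cliffMul n (vec I)).integral_comp_comm it] at h2
    exact h2.symm
  have hz : 0 < ((u : ℂ) - v * Complex.I).re := by simpa using hu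
  rw [hadd, ← integral_congr_ae (Eventually.of_forall h1),
    (sliceMul I hI (-(Real.pi : ℂ)⁻¹)).integral_comp_comm
      (integrable_sliceMul_inv_sq hI hw hz), h0, map_zero]

end

/-! ### The slice extension is slice monogenic -/

section

variable {n : ℕ} {F : ℝ → ℝ → Cl n}

theorem hasDerivAt_cliffMul_const_left (a : Cl n) {f : ℝ → Cl n} {f' : Cl n} {x : ℝ}
    (hf : HasDerivAt f f' x) : HasDerivAt (fun y => a * f y) (a * f') x :=
  (cliffMul n a).hasFDerivAt.comp_hasDerivAt x hf

theorem differentiableAt_sliceExt_of_ne {I : EuclideanSpace ℝ (Fin n)} {x : Paravector n}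
    (hx : x.2 ≠ 0)
    (h1 : DifferentiableAt ℝ (fun y : ℝ × ℝ => F y.1 y.2) (x.1, ‖x.2‖))
    (h2 : DifferentiableAt ℝ (fun y : ℝ × ℝ => F y.1 y.2) (x.1, -‖x.2‖)) :
    DifferentiableAt ℝ (sliceExt I F) x := by
  have hn : DifferentiableAt ℝ (fun y : Paravector n => ‖y.2‖) x :=
    (differentiableAt_snd).norm ℝ hx
  have e1 : DifferentiableAt ℝ (fun y : Paravector n => F y.1 ‖y.2‖) x :=
    DifferentiableAt.comp (f := fun y : Paravector n => (y.1, ‖y.2‖)) x h1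
      (differentiableAt_fst.prodMk hn)
  have e2 : DifferentiableAt ℝ (fun y : Paravector n => F y.1 (-‖y.2‖)) x :=
    DifferentiableAt.comp (f := fun y : Paravector n => (y.1, -‖y.2‖)) x h2
      (differentiableAt_fst.prodMk hn.neg)
  have e3 : DifferentiableAt ℝ (fun y : Paravector n => ‖y.2‖⁻¹ • y.2) x :=
    (hn.inv (norm_ne_zero_iff.2 hx)).smul differentiableAt_snd
  set ιL : EuclideanSpace ℝ (Fin n) →L[ℝ] Cl n :=
    LinearMap.toContinuousLinearMap (CliffordAlgebra.ι (cliffQ n))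
  have e4 : DifferentiableAt ℝ (fun y : Paravector n => vec (‖y.2‖⁻¹ • y.2) * vec I) x :=
    ((cliffMul n).flip (vec I)).differentiableAt.comp x (ιL.differentiableAt.comp x e3)
  have e5 : DifferentiableAt ℝ (fun y : Paravector n => cliffMul n
      (vec (‖y.2‖⁻¹ • y.2) * vec I) (F y.1 (-‖y.2‖) - F y.1 ‖y.2‖)) x :=
    ((cliffMul n).differentiableAt.comp x e4).clm_apply (e2.sub e1)
  exact ((e2.add e1).const_smul (1 / 2 : ℝ)).add (e5.const_smul (1 / 2 : ℝ))

/-- Although `x ↦ ‖x.2‖` is not differentiable at `0`, the displacement `(x.1 - u, σ‖x.2‖)` has the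
same sup norm as `x - (u, 0)`, so the remainder stays `o`. -/
theorem isLittleO_comp_of_hasFDerivAt {E : Type*} [NormedAddCommGroup E] [NormedSpace ℝ E]
    {G : ℝ × ℝ → E} {G' : ℝ × ℝ →L[ℝ] E} {u : ℝ}
    (h : HasFDerivAt G G' (u, 0)) {σ : ℝ} (hσ : |σ| = 1) :
    (fun x : Paravector n => G (x.1, σ * ‖x.2‖) - G (u, 0) - G' (x.1 - u, σ * ‖x.2‖)) =o[𝓝 (u, 0)]
      fun x : Paravector n => x - (u, 0) := by
  have hc : Tendsto (fun x : Paravector n => (x.1, σ * ‖x.2‖)) (𝓝 (u, 0)) (𝓝 (u, 0)) := by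
    have : Continuous fun x : Paravector n => (x.1, σ * ‖x.2‖) := by fun_prop
    simpa using this.tendsto (u, 0)
  have h1 := (hasFDerivAt_iff_isLittleO.1 h).comp_tendsto hc
  simp only [Function.comp_def, Prod.mk_sub_mk, sub_zero] at h1
  refine h1.trans_isBigO (Asymptotics.isBigO_of_le _ fun x => ?_)
  simp [Prod.norm_def, hσ]

/-- With `r = ‖x.2‖`, the odd bracket is `-2rb + o`, and the factor `r` cancels the one in `x.2 /
r`. This leaves the linear term `-x.2 I b`; the Cauchy-Riemann equation plays no role. -/
theorem differentiableAt_sliceExt_of_eq_zero {I : EuclideanSpace ℝ (Fin n)} {u : ℝ} {a b : Cl n}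
    (h : HasFDerivAt (fun y : ℝ × ℝ => F y.1 y.2) (pairSmul a b) (u, 0)) :
    DifferentiableAt ℝ (sliceExt I F) ((u, 0) : Paravector n) := by
  set ιL : EuclideanSpace ℝ (Fin n) →L[ℝ] Cl n :=
    LinearMap.toContinuousLinearMap (CliffordAlgebra.ι (cliffQ n)) with hι
  have hιa : ∀ y, ιL y = vec y := fun _ => rfl
  have hp := isLittleO_comp_of_hasFDerivAt (n := n) h (σ := 1) (by simp)
  have hm := isLittleO_comp_of_hasFDerivAt (n := n) h (σ := -1) (by simp)
  simp only [pairSmul_apply, one_mul, neg_one_mul] at hp hm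
  set ep : Paravector n → Cl n :=
    fun x => F x.1 ‖x.2‖ - F u 0 - ((x.1 - u) • a + ‖x.2‖ • b) with hep
  set em : Paravector n → Cl n :=
    fun x => F x.1 (-‖x.2‖) - F u 0 - ((x.1 - u) • a + (-‖x.2‖) • b) with hem
  set D : Paravector n →L[ℝ] Cl n :=
    (ContinuousLinearMap.fst ℝ ℝ (EuclideanSpace ℝ (Fin n))).smulRight a -
      ((cliffMul n).flip (vec I * b)).comp
        (ιL.comp (ContinuousLinearMap.snd ℝ ℝ (EuclideanSpace ℝ (Fin n)))) with hD
  have hD' : ∀ x : Paravector n, D x = x.1 • a - vec x.2 * (vec I * b) := fun _ => rfl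
  suffices HasFDerivAt (sliceExt I F) D ((u, 0) : Paravector n) from this.differentiableAt
  rw [hasFDerivAt_iff_isLittleO]
  have hid : ∀ x : Paravector n, sliceExt I F x - sliceExt I F (u, 0) - D (x - (u, 0)) =
      ((1 / 2 : ℝ) • (em x + ep x)) +
        (1 / 2 : ℝ) • (vec (‖x.2‖⁻¹ • x.2) * (vec I * (em x - ep x))) := by
    intro x
    have h1 : em x + ep x = F x.1 (-‖x.2‖) + F x.1 ‖x.2‖ - (2 : ℝ) • F u 0 -
        (2 : ℝ) • (x.1 - u) • a := by
      simp only [hem, hep]; module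
    have h2 : em x - ep x = F x.1 (-‖x.2‖) - F x.1 ‖x.2‖ + (2 : ℝ) • ‖x.2‖ • b := by
      simp only [hem, hep]; module
    have h3 : vec (‖x.2‖⁻¹ • x.2) * (vec I * ((2 : ℝ) • ‖x.2‖ • b)) =
        (2 : ℝ) • (vec x.2 * (vec I * b)) := by
      rw [vec, map_smul, mul_smul_comm, mul_smul_comm, mul_smul_comm, mul_smul_comm,
        smul_mul_assoc]
      congr 1
      by_cases h0 : x.2 = 0
      · simp [h0]
      · rw [smul_smul, mul_inv_cancel₀ (norm_ne_zero_iff.2 h0), one_smul]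
    have h4 : sliceExt I F (u, 0) = F u 0 := by
      simp only [sliceExt, norm_zero, neg_zero, sub_self, mul_zero, smul_zero, add_zero]
      module
    rw [h4, hD', h1, h2, mul_add, mul_add, h3, sliceExt, mul_assoc]
    simp only [Prod.fst_sub, Prod.snd_sub, sub_zero]
    module
  have hsum : (fun x => em x + ep x) =o[𝓝 (u, 0)] fun x : Paravector n => x - (u, 0) := hm.add hp
  have hdiff : (fun x => em x - ep x) =o[𝓝 (u, 0)] fun x : Paravector n => x - (u, 0) := hm.sub hp
  -- The unit vector `x.2 / ‖x.2‖` is bounded, also at `x.2 = 0`, where it is `0` by convention.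
  have hmul : (fun x : Paravector n => vec (‖x.2‖⁻¹ • x.2) * (vec I * (em x - ep x))) =O[𝓝 (u, 0)]
      fun x => em x - ep x := by
    refine Asymptotics.IsBigO.of_bound (‖cliffMul n‖ * ‖ιL‖ * (‖cliffMul n‖ * ‖vec I‖))
      (Eventually.of_forall fun x => ?_)
    have h5 : ‖vec (‖x.2‖⁻¹ • x.2)‖ ≤ ‖ιL‖ := by
      refine (ιL.le_opNorm _).trans (mul_le_of_le_one_right (norm_nonneg _) ?_)
      rw [norm_smul, norm_inv, norm_norm]
      exact inv_mul_le_one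
    calc _ ≤ ‖cliffMul n‖ * ‖vec (‖x.2‖⁻¹ • x.2)‖ * ‖vec I * (em x - ep x)‖ :=
          norm_mul_le_cliffMul _ _
      _ ≤ ‖cliffMul n‖ * ‖ιL‖ * (‖cliffMul n‖ * ‖vec I‖ * ‖em x - ep x‖) := by
          gcongr
          exact norm_mul_le_cliffMul _ _
      _ = _ := by ring
  refine ((hsum.const_smul_left (1 / 2 : ℝ)).add
    ((hmul.trans_isLittleO hdiff).const_smul_left (1 / 2 : ℝ))).congr (fun x => ?_) fun _ => rfl
  exact (hid x).symm

theorem sliceMonogenicOn_sliceExt {I : EuclideanSpace ℝ (Fin n)} (hI : I ∈ imagSphere n)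
    {Fu Fv : ℝ → ℝ → Cl n}
    (hF : ∀ u v, 0 < u → HasFDerivAt (fun y : ℝ × ℝ => F y.1 y.2) (pairSmul (Fu u v) (Fv u v))
      (u, v))
    (hCR : ∀ u v, 0 < u → Fu u v + vec I * Fv u v = 0) :
    SliceMonogenicOn (rightHalfSpace n) (sliceExt I F) := by
  have hdu : ∀ u v, 0 < u → HasDerivAt (fun s => F s v) (Fu u v) u := by
    intro u v hu
    have h := (hF u v hu).comp_hasDerivAt u ((hasDerivAt_id u).prodMk (hasDerivAt_const u v))
    simpa using! h
  have hdv : ∀ u v, 0 < u → HasDerivAt (fun t => F u t) (Fv u v) v := by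
    intro u v hu
    have h := (hF u v hu).comp_hasDerivAt v ((hasDerivAt_const v u).prodMk (hasDerivAt_id v))
    simpa using! h
  refine ⟨fun x hx => ?_, fun J hJ u v huv => ?_⟩
  · have hx1 : 0 < x.1 := hx
    refine DifferentiableAt.differentiableWithinAt ?_
    by_cases h0 : x.2 = 0
    · obtain ⟨u, y⟩ := x
      obtain rfl : y = 0 := h0
      exact differentiableAt_sliceExt_of_eq_zero (hF u 0 hx1)
    · exact differentiableAt_sliceExt_of_ne h0 (hF _ _ hx1).differentiableAt
        (hF _ _ hx1).differentiableAt
  · have hu : 0 < u := huv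
    have hneg : HasDerivAt (fun t => F u (-t)) (-Fv u (-v)) v := by
      have h := (hdv u (-v) hu).scomp v (hasDerivAt_neg v)
      simpa using! h
    have d1 : HasDerivAt (fun s => sliceExt I F (slicePoint J s v))
        ((1 / 2 : ℝ) • (Fu u (-v) + Fu u v) +
          (1 / 2 : ℝ) • (vec J * vec I * (Fu u (-v) - Fu u v))) u := by
      simp only [sliceExt_slicePoint I J hJ]
      exact (((hdu u (-v) hu).add (hdu u v hu)).const_smul (1 / 2 : ℝ)).add
        ((hasDerivAt_cliffMul_const_left _ ((hdu u (-v) hu).sub (hdu u v hu))).const_smul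
          (1 / 2 : ℝ))
    have d2 : HasDerivAt (fun t => sliceExt I F (slicePoint J u t))
        ((1 / 2 : ℝ) • (-Fv u (-v) + Fv u v) +
          (1 / 2 : ℝ) • (vec J * vec I * (-Fv u (-v) - Fv u v))) v := by
      simp only [sliceExt_slicePoint I J hJ]
      exact ((hneg.add (hdv u v hu)).const_smul (1 / 2 : ℝ)).add
        ((hasDerivAt_cliffMul_const_left _ (hneg.sub (hdv u v hu))).const_smul (1 / 2 : ℝ))
    rw [d1.deriv, d2.deriv]
    have hI2 : ∀ c : Cl n, vec I * (vec I * c) = -c := fun c => by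
      rw [← mul_assoc, vec_mul_self_of_mem hI, neg_one_mul]
    have hJ2 : ∀ c : Cl n, vec J * (vec J * c) = -c := fun c => by
      rw [← mul_assoc, vec_mul_self_of_mem hJ, neg_one_mul]
    -- Replacing `Fu` by `-I Fv` at both `v` and `-v` leaves only `v`-derivatives, and these cancel
    -- by `I² = J² = -1`.
    rw [eq_neg_of_add_eq_zero_left (hCR u v hu), eq_neg_of_add_eq_zero_left (hCR u (-v) hu)]
    simp only [mul_add, mul_sub, mul_neg, mul_smul_comm, mul_assoc, hI2, hJ2]
    module

end

/-! ### Nontangential boundary limits of Poisson integrals -/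

/-- Take the least admissible `k`. For `k ≥ 1` minimality gives `|t| > 2^(k-1) u`, and the kernel is
at most `u / (π t²)`; the shift from `k` to `k - 1` costs the factor 4. -/
theorem exists_dyadic_poissonKernel_le {u : ℝ} (hu : 0 < u) (t : ℝ) :
    ∃ k : ℕ, |t| ≤ 2 ^ k * u ∧ poissonKernel u t ≤ 4 * (4 ^ k)⁻¹ / u := by
  have hpi := Real.pi_gt_three
  have hex : ∃ k : ℕ, |t| ≤ 2 ^ k * u := by
    obtain ⟨k, hk⟩ := pow_unbounded_of_one_lt (|t| / u) one_lt_two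
    exact ⟨k, by rw [← div_le_iff₀ hu]; exact hk.le⟩
  classical
  refine ⟨Nat.find hex, Nat.find_spec hex, ?_⟩
  rw [poissonKernel, div_le_div_iff₀ (by positivity) hu]
  rcases hk : Nat.find hex with _ | k
  · simp only [pow_zero, inv_one, mul_one]
    nlinarith [sq_nonneg t, sq_nonneg u]
  · have hlt : ¬ |t| ≤ 2 ^ k * u := Nat.find_min hex (by omega)
    have h1 : (2 ^ k * u) ^ 2 ≤ t ^ 2 := by
      rw [← sq_abs t]
      exact pow_le_pow_left₀ (by positivity) (not_le.1 hlt).le 2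
    have h2 : (4 : ℝ) ^ k = (2 ^ k) ^ 2 := by rw [← pow_mul, mul_comm, pow_mul]; norm_num
    have h3 : (4 : ℝ) ^ k * u ^ 2 ≤ t ^ 2 := by rw [h2, ← mul_pow]; exact h1
    have h4 : u ^ 2 ≤ (4 ^ k)⁻¹ * t ^ 2 := by
      rw [← div_eq_inv_mul, le_div_iff₀ (by positivity)]; linarith
    have h5 : 4 * ((4 : ℝ) ^ (k + 1))⁻¹ = (4 ^ k)⁻¹ := by
      rw [pow_succ]; field_simp
    rw [h5]
    have h6 : 0 ≤ ((4 : ℝ) ^ k)⁻¹ * t ^ 2 := by positivity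
    have h7 : 0 ≤ ((4 : ℝ) ^ k)⁻¹ * u ^ 2 := by positivity
    nlinarith

theorem ofReal_poissonKernel_le_tsum {u : ℝ} (hu : 0 < u) (t : ℝ) :
    ENNReal.ofReal (poissonKernel u t) ≤ ∑' k : ℕ, ENNReal.ofReal (4 * (4 ^ k)⁻¹ / u) *
      (Metric.closedBall (0 : ℝ) (2 ^ k * u)).indicator 1 t := by
  obtain ⟨k, hk1, hk2⟩ := exists_dyadic_poissonKernel_le hu t
  refine le_trans ?_ (ENNReal.le_tsum k)
  rw [Set.indicator_of_mem (by simpa using hk1), Pi.one_apply, mul_one]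
  exact ENNReal.ofReal_le_ofReal hk2

/-- The terms are `8 · 2^{-k} ε`: ball size grows like `2^k`, kernel height decays like `4^{-k}`. -/
theorem tsum_ofReal_dyadic {u : ℝ} (hu : 0 < u) (ε : ℝ≥0∞) :
    ∑' k : ℕ, ENNReal.ofReal (4 * (4 ^ k)⁻¹ / u) * (ε * ENNReal.ofReal (2 * (2 ^ k * u))) =
      16 * ε := by
  have h : ∀ k : ℕ, ENNReal.ofReal (4 * (4 ^ k)⁻¹ / u) * (ε * ENNReal.ofReal (2 * (2 ^ k * u))) =
      ε * ENNReal.ofReal (8 * (1 / 2) ^ k) := by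
    intro k
    rw [mul_left_comm, ← ENNReal.ofReal_mul (by positivity)]
    congr 2
    have h4 : (4 : ℝ) ^ k = 2 ^ k * 2 ^ k := by rw [← mul_pow]; norm_num
    rw [h4, one_div, inv_pow]
    field_simp
    norm_num
  simp_rw [h]
  rw [ENNReal.tsum_mul_left, ← ENNReal.ofReal_tsum_of_nonneg (fun k => by positivity)
    (summable_geometric_two.mul_left 8), tsum_mul_left, tsum_geometric_two, mul_comm]
  norm_num

theorem setLIntegral_closedBall_poissonKernel_le {h : ℝ → ℝ≥0∞} (hh : AEMeasurable h) {v δ : ℝ}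
    (hδ : 0 < δ) {ε : ℝ≥0∞}
    (hε : ∀ r, 0 < r → r ≤ δ →
      ∫⁻ w in Metric.closedBall v r, h w ≤ ε * ENNReal.ofReal (2 * r))
    {u : ℝ} (hu : 0 < u) :
    ∫⁻ w in Metric.closedBall v δ, ENNReal.ofReal (poissonKernel u (v - w)) * h w ≤ 16 * ε := by
  have hind : ∀ (k : ℕ) (w : ℝ), (Metric.closedBall (0 : ℝ) (2 ^ k * u)).indicator
      (1 : ℝ → ℝ≥0∞) (v - w) * h w = (Metric.closedBall v (2 ^ k * u)).indicator h w := by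
    intro k w
    have hiff : v - w ∈ Metric.closedBall (0 : ℝ) (2 ^ k * u) ↔
        w ∈ Metric.closedBall v (2 ^ k * u) := by
      rw [mem_closedBall_zero_iff, mem_closedBall_iff_norm']
    by_cases hw : w ∈ Metric.closedBall v (2 ^ k * u)
    · rw [Set.indicator_of_mem (hiff.2 hw), Set.indicator_of_mem hw, Pi.one_apply, one_mul]
    · rw [Set.indicator_of_notMem (fun h => hw (hiff.1 h)), Set.indicator_of_notMem hw, zero_mul]
  calc ∫⁻ w in Metric.closedBall v δ, ENNReal.ofReal (poissonKernel u (v - w)) * h w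
      ≤ ∫⁻ w in Metric.closedBall v δ, ∑' k : ℕ, ENNReal.ofReal (4 * (4 ^ k)⁻¹ / u) *
          (Metric.closedBall v (2 ^ k * u)).indicator h w := by
        refine lintegral_mono fun w => ?_
        refine (mul_le_mul_left (ofReal_poissonKernel_le_tsum hu (v - w)) (h w)).trans_eq ?_
        rw [← ENNReal.tsum_mul_right]
        simp only [mul_assoc, hind]
    _ = ∑' k : ℕ, ENNReal.ofReal (4 * (4 ^ k)⁻¹ / u) *
          ∫⁻ w in Metric.closedBall v δ, (Metric.closedBall v (2 ^ k * u)).indicator h w := by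
        rw [lintegral_tsum]
        · refine tsum_congr fun k => lintegral_const_mul' _ _ ENNReal.ofReal_ne_top
        · exact fun k => ((hh.indicator Metric.isClosed_closedBall.measurableSet).const_mul
            _).restrict
    _ ≤ ∑' k : ℕ, ENNReal.ofReal (4 * (4 ^ k)⁻¹ / u) *
          (ε * ENNReal.ofReal (2 * (2 ^ k * u))) := by
        refine ENNReal.tsum_le_tsum fun k => mul_le_mul_right ?_ _
        rw [lintegral_indicator Metric.isClosed_closedBall.measurableSet,
          Measure.restrict_restrict Metric.isClosed_closedBall.measurableSet]
        -- A dyadic ball larger than `δ` meets the domain only inside the `δ`-ball, where the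
        -- hypothesis at `r = δ` suffices.
        rcases le_total (2 ^ k * u) δ with hle | hle
        · exact (lintegral_mono_set Set.inter_subset_left).trans (hε _ (by positivity) hle)
        · refine (lintegral_mono_set Set.inter_subset_right).trans ((hε δ hδ le_rfl).trans ?_)
          gcongr
    _ = 16 * ε := tsum_ofReal_dyadic hu ε

theorem poissonKernel_le_of_lt_abs {δ u t : ℝ} (hδ : 0 < δ) (hu : 0 < u) (ht : δ < |t|) :
    poissonKernel u t ≤ u * (1 + 1 / δ ^ 2) * (1 + t ^ 2)⁻¹ := by
  have h1 : δ ^ 2 ≤ t ^ 2 := by rw [← sq_abs t]; gcongr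
  have ht2 : 0 < t ^ 2 := lt_of_lt_of_le (by positivity) h1
  have h2 : 1 + t ^ 2 ≤ (1 + 1 / δ ^ 2) * t ^ 2 := by
    have : 1 ≤ 1 / δ ^ 2 * t ^ 2 := by
      rw [one_div, inv_mul_eq_div, le_div_iff₀ (by positivity)]; linarith
    linarith
  have h3 : t ^ 2 ≤ Real.pi * (u ^ 2 + t ^ 2) := by
    nlinarith [Real.pi_gt_three, sq_nonneg u]
  rw [← div_eq_mul_inv, poissonKernel, div_le_div_iff₀ (by positivity) (by positivity), mul_assoc]
  refine mul_le_mul_of_nonneg_left (h2.trans ?_) hu.le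
  gcongr

/-- Within distance `δ` the dyadic bound costs a factor 16, so averages below `ε/32` give `ε/2`.
Beyond `δ` the kernel is `O(u)` times the integrable weight. -/
theorem tendsto_lintegral_poissonKernel_zero {h : ℝ → ℝ≥0∞} (hh : AEMeasurable h) {v : ℝ}
    (hv : Tendsto (fun r => (∫⁻ w in Metric.closedBall v r, h w) /
      volume (Metric.closedBall v r)) (𝓝[>] 0) (𝓝 0))
    (hfin : ∫⁻ w, ENNReal.ofReal ((1 + (v - w) ^ 2)⁻¹) * h w ≠ ⊤) :
    Tendsto (fun u => ∫⁻ w, ENNReal.ofReal (poissonKernel u (v - w)) * h w) (𝓝[>] 0) (𝓝 0) := by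
  rw [ENNReal.tendsto_nhds_zero] at hv ⊢
  intro ε hε
  have hε' : 0 < ε / 32 := ENNReal.div_pos hε.ne' (by norm_num)
  obtain ⟨δ, hδ, hball⟩ := mem_nhdsGT_iff_exists_Ioc_subset.1 (hv _ hε')
  have hδ0 : 0 < δ := hδ
  have hb : ∀ r, 0 < r → r ≤ δ →
      ∫⁻ w in Metric.closedBall v r, h w ≤ ε / 32 * ENNReal.ofReal (2 * r) := by
    intro r hr hrδ
    have h1 : (∫⁻ w in Metric.closedBall v r, h w) / volume (Metric.closedBall v r) ≤ ε / 32 :=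
      hball ⟨hr, hrδ⟩
    rw [Real.volume_closedBall] at h1
    exact (ENNReal.div_le_iff (by simpa using hr) ENNReal.ofReal_ne_top).1 h1
  set M := ∫⁻ w, ENNReal.ofReal ((1 + (v - w) ^ 2)⁻¹) * h w with hM
  have hfar : Tendsto (fun u : ℝ => ENNReal.ofReal (u * (1 + 1 / δ ^ 2)) * M) (𝓝[>] 0)
      (𝓝 0) := by
    have h1 : Tendsto (fun u : ℝ => ENNReal.ofReal (u * (1 + 1 / δ ^ 2))) (𝓝[>] 0) (𝓝 0) := by
      have h2 : Continuous fun u : ℝ => ENNReal.ofReal (u * (1 + 1 / δ ^ 2)) :=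
        ENNReal.continuous_ofReal.comp (by fun_prop)
      simpa using (h2.tendsto 0).mono_left nhdsWithin_le_nhds
    simpa using ENNReal.Tendsto.mul_const h1 (Or.inr hfin)
  have hε2 : 0 < ε / 2 := ENNReal.div_pos hε.ne' (by norm_num)
  filter_upwards [ENNReal.tendsto_nhds_zero.1 hfar _ hε2, self_mem_nhdsWithin] with u hu1 hu
  have hu0 : 0 < u := hu
  rw [← lintegral_add_compl _ (Metric.isClosed_closedBall (x := v) (ε := δ)).measurableSet]
  have hnear := setLIntegral_closedBall_poissonKernel_le hh hδ0 hb hu0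
  have h16 : 16 * (ε / 32) = ε / 2 := by
    rw [← mul_div_assoc, mul_comm, ENNReal.div_eq_inv_mul, ENNReal.div_eq_inv_mul, mul_comm,
      mul_assoc, mul_comm]
    congr 1
    rw [show (32 : ℝ≥0∞) = 16 * 2 by norm_num, ENNReal.mul_inv (by simp) (by simp), ← mul_assoc,
      ENNReal.mul_inv_cancel (by simp) (by simp), one_mul]
  rw [h16] at hnear
  refine (add_le_add hnear (le_trans ?_ hu1)).trans_eq (ENNReal.add_halves ε)
  rw [hM, ← lintegral_const_mul' _ _ ENNReal.ofReal_ne_top]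
  refine (setLIntegral_mono' Metric.isClosed_closedBall.measurableSet.compl fun w hw => ?_).trans
    (setLIntegral_le_lintegral _ _)
  rw [← mul_assoc, ← ENNReal.ofReal_mul (by positivity)]
  gcongr
  refine poissonKernel_le_of_lt_abs hδ0 hu0 ?_
  rw [Set.mem_compl_iff, mem_closedBall_iff_norm', not_le, Real.norm_eq_abs] at hw
  exact hw

/-- Reduces approach in a cone to radial approach at its vertex, via `(v₀ - w)² ≤ 2(v - w)² +
2a²u²`. -/
theorem poissonKernel_le_of_mem_cone {a u v v₀ : ℝ} (hu : 0 < u) (hv : |v - v₀| < a * u) (w : ℝ) :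
    poissonKernel u (v - w) ≤ (2 + 2 * a ^ 2) * poissonKernel u (v₀ - w) := by
  have h1 : (v - v₀) ^ 2 ≤ a ^ 2 * u ^ 2 := by
    rw [← mul_pow, ← sq_abs (v - v₀)]
    exact pow_le_pow_left₀ (abs_nonneg _) hv.le 2
  unfold poissonKernel
  rw [← mul_div_assoc, div_le_div_iff₀ (by positivity) (by positivity)]
  have h2 : u ^ 2 + (v₀ - w) ^ 2 ≤ (2 + 2 * a ^ 2) * (u ^ 2 + (v - w) ^ 2) := by
    nlinarith [sq_nonneg ((v - w) + (v - v₀)), sq_nonneg (v - w), sq_nonneg u, sq_nonneg a,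
      mul_nonneg (sq_nonneg a) (sq_nonneg (v - w))]
  have h3 := mul_le_mul_of_nonneg_left h2 (by positivity : 0 ≤ u * Real.pi)
  linarith

theorem lintegral_ofReal_poissonKernel {u : ℝ} (hu : 0 < u) :
    ∫⁻ t, ENNReal.ofReal (poissonKernel u t) = 1 := by
  rw [← ofReal_integral_eq_lintegral_ofReal (integrable_poissonKernel hu)
    (Eventually.of_forall (poissonKernel_nonneg hu)), integral_poissonKernel hu,
    ENNReal.ofReal_one]

/-- Jensen's inequality: the kernel is a probability density, and `L^1` norms are at most `L^p`
norms for such a measure. -/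
theorem lintegral_poissonKernel_mul_rpow_le {E : Type*} [NormedAddCommGroup E] {g : ℝ → E}
    (hg : AEStronglyMeasurable g volume) {p : ℝ} (hp : 1 ≤ p) {u : ℝ} (hu : 0 < u) (v : ℝ) :
    (∫⁻ w, ENNReal.ofReal (poissonKernel u (v - w)) * ‖g w‖ₑ) ^ p ≤
      ∫⁻ w, ENNReal.ofReal (poissonKernel u (v - w)) * ‖g w‖ₑ ^ p := by
  have hd : Measurable fun w => ENNReal.ofReal (poissonKernel u (v - w)) :=
    ((continuous_poissonKernel hu).measurable.comp
      (measurable_const.sub measurable_id)).ennreal_ofReal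
  set ν := volume.withDensity fun w => ENNReal.ofReal (poissonKernel u (v - w)) with hν
  have hprob : IsProbabilityMeasure ν := ⟨by
    rw [hν, withDensity_apply _ MeasurableSet.univ, Measure.restrict_univ,
      lintegral_sub_left_eq_self (fun t => ENNReal.ofReal (poissonKernel u t)) v,
      lintegral_ofReal_poissonKernel hu]⟩
  have h := eLpNorm'_le_eLpNorm'_of_exponent_le one_pos hp ν
    (hg.mono_ac (withDensity_absolutelyContinuous _ _))
  have hp0 : 0 < p := by linarith
  simp only [eLpNorm', ENNReal.rpow_one, one_div, inv_one] at h
  have h2 := ENNReal.rpow_le_rpow h hp0.le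
  rw [ENNReal.rpow_inv_rpow hp0.ne'] at h2
  rw [hν, lintegral_withDensity_eq_lintegral_mul₀ hd.aemeasurable hg.enorm,
    lintegral_withDensity_eq_lintegral_mul₀ hd.aemeasurable (hg.enorm.pow_const p)] at h2
  exact h2

section

variable {E : Type*} [NormedAddCommGroup E] [NormedSpace ℝ E] {g : ℝ → E}

theorem enorm_poissonKernel_smul {u : ℝ} (hu : 0 < u) (t : ℝ) (x : E) :
    ‖poissonKernel u t • x‖ₑ = ENNReal.ofReal (poissonKernel u t) * ‖x‖ₑ := by
  rw [enorm_smul, Real.enorm_of_nonneg (poissonKernel_nonneg hu t)]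

theorem tendsto_poissonKernel_cone [CompleteSpace E]
    (hw : Integrable fun w => (1 + w ^ 2)⁻¹ • g w) (hg : AEStronglyMeasurable g volume) {v : ℝ}
    (hv : Tendsto (fun r => (∫⁻ w in Metric.closedBall v r, ‖g w - g v‖ₑ) /
      volume (Metric.closedBall v r)) (𝓝[>] 0) (𝓝 0)) (a : ℝ) :
    Tendsto (fun z : ℝ × ℝ => ∫ w, poissonKernel z.1 (z.2 - w) • g w)
      (𝓝[{z : ℝ × ℝ | 0 < z.1 ∧ |z.2 - v| < a * z.1}] (0, v)) (𝓝 (g v)) := by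
  have hm : AEMeasurable (fun w => ‖g w - g v‖ₑ) :=
    (hg.sub aestronglyMeasurable_const).enorm
  have hinv : Continuous fun t : ℝ => (1 + t ^ 2)⁻¹ :=
    Continuous.inv₀ (by fun_prop) fun t => by positivity
  have hfin : ∫⁻ w, ENNReal.ofReal ((1 + (v - w) ^ 2)⁻¹) * ‖g w - g v‖ₑ ≠ ⊤ := by
    have h1 := integrable_kernel_smul hw hinv one_pos zero_le_one (fun t => by
      rw [abs_of_pos (by positivity), one_pow, one_mul]) v
    have h2 := (integrable_inv_one_add_sq.comp_sub_left v).smul_const (g v)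
    have h3 := (h1.sub h2).2
    rw [hasFiniteIntegral_iff_enorm] at h3
    refine ne_of_eq_of_ne (lintegral_congr fun w => ?_) h3.ne
    rw [Pi.sub_apply, ← smul_sub, enorm_smul, Real.enorm_of_nonneg (by positivity)]
  have hlim := tendsto_lintegral_poissonKernel_zero hm hv hfin
  set S := {z : ℝ × ℝ | 0 < z.1 ∧ |z.2 - v| < a * z.1} with hS
  have hfst : Tendsto (fun z : ℝ × ℝ => z.1) (𝓝[S] (0, v)) (𝓝[>] 0) := by
    refine tendsto_nhdsWithin_iff.2
      ⟨(continuous_fst.tendsto ((0 : ℝ), v)).mono_left nhdsWithin_le_nhds, ?_⟩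
    filter_upwards [self_mem_nhdsWithin] with z hz using hz.1
  have hlim2 := ENNReal.Tendsto.const_mul (a := ENNReal.ofReal (2 + 2 * a ^ 2))
    (hlim.comp hfst) (Or.inr ENNReal.ofReal_ne_top)
  rw [mul_zero] at hlim2
  rw [tendsto_iff_edist_tendsto_0]
  refine tendsto_of_tendsto_of_tendsto_of_le_of_le' tendsto_const_nhds hlim2
    (Eventually.of_forall fun _ => zero_le) ?_
  filter_upwards [self_mem_nhdsWithin] with z hz
  have hz1 : 0 < z.1 := hz.1
  -- The kernel has mass one, so `g v` can be moved inside the integral.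
  have hdiff : (∫ w, poissonKernel z.1 (z.2 - w) • g w) - g v =
      ∫ w, poissonKernel z.1 (z.2 - w) • (g w - g v) := by
    simp only [smul_sub]
    rw [integral_sub (integrable_poissonKernel_smul hw hz1 z.2)
      (((integrable_poissonKernel hz1).comp_sub_left z.2).smul_const (g v)), integral_smul_const,
      integral_sub_left_eq_self (poissonKernel z.1) volume z.2, integral_poissonKernel hz1,
      one_smul]
  rw [edist_eq_enorm_sub, hdiff]
  refine (enorm_integral_le_lintegral_enorm _).trans ?_
  rw [Function.comp_apply, ← lintegral_const_mul' _ _ ENNReal.ofReal_ne_top]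
  refine lintegral_mono fun w => ?_
  rw [enorm_poissonKernel_smul hz1, ← mul_assoc, ← ENNReal.ofReal_mul (by positivity)]
  gcongr
  exact poissonKernel_le_of_mem_cone hz1 hz.2 w

/-- The good points are the Lebesgue points of `g`, so the exceptional null set is the same for all
apertures `a`. -/
theorem ae_tendsto_poissonKernel_cone [CompleteSpace E] {p : ℝ} (hp : 1 ≤ p)
    (hg : MemLp g (ENNReal.ofReal p) volume) :
    ∀ᵐ v : ℝ, ∀ a : ℝ, Tendsto (fun z : ℝ × ℝ => ∫ w, poissonKernel z.1 (z.2 - w) • g w)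
      (𝓝[{z : ℝ × ℝ | 0 < z.1 ∧ |z.2 - v| < a * z.1}] (0, v)) (𝓝 (g v)) := by
  have hloc := hg.locallyIntegrable (by simpa using hp)
  filter_upwards [(Besicovitch.vitaliFamily volume).ae_tendsto_lintegral_enorm_sub_div hloc]
    with v hv a
  exact tendsto_poissonKernel_cone (integrable_inv_one_add_sq_smul hp hg) hg.1
    (hv.comp (Besicovitch.tendsto_filterAt volume v)) a

/-! ### The `L^p` bound for Poisson integrals -/

theorem lintegral_enorm_integral_poissonKernel_smul_rpow_le (hg : AEStronglyMeasurable g volume)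
    {p : ℝ} (hp : 1 ≤ p) {u : ℝ} (hu : 0 < u) :
    ∫⁻ v, ‖∫ w, poissonKernel u (v - w) • g w‖ₑ ^ p ≤ ∫⁻ w, ‖g w‖ₑ ^ p := by
  have hp0 : 0 ≤ p := by linarith
  have hd : Measurable fun y : ℝ × ℝ => ENNReal.ofReal (poissonKernel u (y.1 - y.2)) :=
    ((continuous_poissonKernel hu).measurable.comp
      (measurable_fst.sub measurable_snd)).ennreal_ofReal
  calc ∫⁻ v, ‖∫ w, poissonKernel u (v - w) • g w‖ₑ ^ p
      ≤ ∫⁻ v, ∫⁻ w, ENNReal.ofReal (poissonKernel u (v - w)) * ‖g w‖ₑ ^ p := by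
        refine lintegral_mono fun v => ?_
        refine le_trans (ENNReal.rpow_le_rpow (enorm_integral_le_lintegral_enorm _) hp0) ?_
        simp only [enorm_poissonKernel_smul hu]
        exact lintegral_poissonKernel_mul_rpow_le hg hp hu v
    _ = ∫⁻ w, ∫⁻ v, ENNReal.ofReal (poissonKernel u (v - w)) * ‖g w‖ₑ ^ p :=
        lintegral_lintegral_swap (hd.aemeasurable.mul (hg.enorm.pow_const p).comp_snd)
    _ = ∫⁻ w, ‖g w‖ₑ ^ p := by
        refine lintegral_congr fun w => ?_
        have hd' : Measurable fun v => ENNReal.ofReal (poissonKernel u (v - w)) :=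
          ((continuous_poissonKernel hu).comp
            (continuous_id.sub continuous_const)).measurable.ennreal_ofReal
        rw [lintegral_mul_const _ hd',
          lintegral_sub_right_eq_self (fun t => ENNReal.ofReal (poissonKernel u t)) w,
          lintegral_ofReal_poissonKernel hu, one_mul]

end

/-! ### Boundary values and integral means of the slice extension -/

section

variable {n : ℕ}

/-- The values `(1/2) [a + b] + (J I / 2) [a - b]` of a slice extension on the slice of `J`, for the
values `a = F(u - I v)` and `b = F(u + I v)`. -/
def sliceCombination (I J : EuclideanSpace ℝ (Fin n)) (a b : Cl n) : Cl n :=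
  (1 / 2 : ℝ) • (a + b) + (1 / 2 : ℝ) • (vec J * vec I * (a - b))

theorem sliceCombination_self {I : EuclideanSpace ℝ (Fin n)} (hI : I ∈ imagSphere n) (a b : Cl n) :
    sliceCombination I I a b = b := by
  rw [sliceCombination, vec_mul_self_of_mem hI, neg_one_mul]
  module

theorem continuous_sliceCombination (I J : EuclideanSpace ℝ (Fin n)) :
    Continuous fun y : Cl n × Cl n => sliceCombination I J y.1 y.2 :=
  ((continuous_fst.add continuous_snd).const_smul (1 / 2 : ℝ)).add
    (((cliffMul n (vec J * vec I)).continuous.comp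
      (continuous_fst.sub continuous_snd)).const_smul (1 / 2 : ℝ))

theorem exists_enorm_sliceCombination_le (I : EuclideanSpace ℝ (Fin n)) :
    ∃ K : ℝ, ∀ J ∈ imagSphere n, ∀ a b : Cl n,
      ‖sliceCombination I J a b‖ₑ ≤ ENNReal.ofReal K * (‖a‖ₑ + ‖b‖ₑ) := by
  set ιL : EuclideanSpace ℝ (Fin n) →L[ℝ] Cl n :=
    LinearMap.toContinuousLinearMap (CliffordAlgebra.ι (cliffQ n))
  set M := ‖cliffMul n‖
  refine ⟨1 + M * (M * ‖ιL‖ * ‖vec I‖), fun J hJ a b => ?_⟩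
  have hJ1 : ‖J‖ = 1 := hJ
  have h1 : ‖vec J‖ ≤ ‖ιL‖ := (ιL.le_opNorm J).trans_eq (by rw [hJ1, mul_one])
  have h2 : ‖vec J * vec I‖ ≤ M * ‖ιL‖ * ‖vec I‖ :=
    (norm_mul_le_cliffMul _ _).trans (by gcongr)
  have h3 : ‖vec J * vec I * (a - b)‖ ≤ M * (M * ‖ιL‖ * ‖vec I‖) * (‖a‖ + ‖b‖) :=
    (norm_mul_le_cliffMul _ _).trans (by gcongr; exact norm_sub_le a b)
  have h4 : ‖sliceCombination I J a b‖ ≤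
      (1 + M * (M * ‖ιL‖ * ‖vec I‖)) * (‖a‖ + ‖b‖) := by
    refine (norm_add_le _ _).trans ?_
    rw [norm_smul, norm_smul, Real.norm_of_nonneg (by norm_num : (0 : ℝ) ≤ 1 / 2)]
    have h5 := norm_add_le a b
    have h6 := norm_nonneg (vec J * vec I * (a - b))
    have h7 : 0 ≤ ‖a‖ + ‖b‖ := by positivity
    linarith
  rw [← ofReal_norm, ← ofReal_norm, ← ofReal_norm, ← ENNReal.ofReal_add (norm_nonneg _)
    (norm_nonneg _), ← ENNReal.ofReal_mul (by positivity)]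
  exact ENNReal.ofReal_le_ofReal h4

/-- A bound, uniform in `J`, for the `L^p` means of slice extensions. -/
theorem exists_lintegral_sliceCombination_le (I : EuclideanSpace ℝ (Fin n)) {p : ℝ} (hp : 1 ≤ p) :
    ∃ C : ℝ≥0∞, C ≠ ⊤ ∧ ∀ J ∈ imagSphere n, ∀ φ : ℝ → Cl n, AEStronglyMeasurable φ volume →
      ∫⁻ v, ‖sliceCombination I J (φ (-v)) (φ v)‖ₑ ^ p ≤ C * ∫⁻ v, ‖φ v‖ₑ ^ p := by
  obtain ⟨K, hK⟩ := exists_enorm_sliceCombination_le I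
  have hp0 : 0 ≤ p := by linarith
  refine ⟨ENNReal.ofReal K ^ p * 2 ^ (p - 1) * 2, ?_, fun J hJ φ hφ => ?_⟩
  · refine ENNReal.mul_ne_top (ENNReal.mul_ne_top ?_ ?_) (by norm_num)
    · exact ENNReal.rpow_ne_top_of_nonneg hp0 ENNReal.ofReal_ne_top
    · exact ENNReal.rpow_ne_top_of_nonneg (by linarith) (by norm_num)
  · have hC : ENNReal.ofReal K ^ p * 2 ^ (p - 1) ≠ ⊤ := ENNReal.mul_ne_top
      (ENNReal.rpow_ne_top_of_nonneg hp0 ENNReal.ofReal_ne_top)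
      (ENNReal.rpow_ne_top_of_nonneg (by linarith) (by norm_num))
    calc ∫⁻ v, ‖sliceCombination I J (φ (-v)) (φ v)‖ₑ ^ p
        ≤ ∫⁻ v, ENNReal.ofReal K ^ p * 2 ^ (p - 1) * (‖φ (-v)‖ₑ ^ p + ‖φ v‖ₑ ^ p) := by
          refine lintegral_mono fun v => ?_
          refine (ENNReal.rpow_le_rpow (hK J hJ _ _) hp0).trans ?_
          rw [ENNReal.mul_rpow_of_nonneg _ _ hp0, mul_assoc]
          gcongr
          -- Convexity of `x ↦ x^p` gives the `2 ^ (p - 1)`; the remaining factor 2 comes from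
          -- reflecting `v ↦ -v`.
          exact ENNReal.rpow_add_le_mul_rpow_add_rpow _ _ hp
      _ = ENNReal.ofReal K ^ p * 2 ^ (p - 1) * 2 * ∫⁻ v, ‖φ v‖ₑ ^ p := by
          rw [lintegral_const_mul' _ _ hC, lintegral_add_right' _ (hφ.enorm.pow_const p),
            lintegral_neg_eq_self (fun v => ‖φ v‖ₑ ^ p), ← two_mul, mul_assoc _ 2]

theorem sliceExt_slicePoint_eq {I J : EuclideanSpace ℝ (Fin n)} (hJ : J ∈ imagSphere n)
    (F : ℝ → ℝ → Cl n) (u v : ℝ) :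
    sliceExt I F (slicePoint J u v) = sliceCombination I J (F u (-v)) (F u v) :=
  sliceExt_slicePoint I J hJ F u v

theorem hasNTBL_sliceExt {I J : EuclideanSpace ℝ (Fin n)} (hJ : J ∈ imagSphere n)
    {F : ℝ → ℝ → Cl n} {g : ℝ → Cl n} {v : ℝ}
    (hv : ∀ a : ℝ, Tendsto (fun z : ℝ × ℝ => F z.1 z.2)
      (𝓝[{z : ℝ × ℝ | 0 < z.1 ∧ |z.2 - v| < a * z.1}] (0, v)) (𝓝 (g v)))
    (hv' : ∀ a : ℝ, Tendsto (fun z : ℝ × ℝ => F z.1 z.2)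
      (𝓝[{z : ℝ × ℝ | 0 < z.1 ∧ |z.2 - -v| < a * z.1}] (0, -v)) (𝓝 (g (-v)))) :
    HasNTBL (sliceExt I F) J v (sliceCombination I J (g (-v)) (g v)) := by
  intro a _
  have hneg : Tendsto (fun z : ℝ × ℝ => (z.1, -z.2))
      (𝓝[{z : ℝ × ℝ | 0 < z.1 ∧ |z.2 - v| < a * z.1}] (0, v))
      (𝓝[{z : ℝ × ℝ | 0 < z.1 ∧ |z.2 - -v| < a * z.1}] (0, -v)) := by
    refine tendsto_nhdsWithin_iff.2 ⟨?_, ?_⟩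
    · have h : Continuous fun z : ℝ × ℝ => (z.1, -z.2) := by fun_prop
      exact (h.tendsto (0, v)).mono_left nhdsWithin_le_nhds
    · filter_upwards [self_mem_nhdsWithin] with z hz
      refine ⟨hz.1, ?_⟩
      rw [neg_sub_neg, abs_sub_comm]
      exact hz.2
  have h := ((continuous_sliceCombination I J).tendsto (g (-v), g v)).comp
    (((hv' a).comp hneg).prodMk_nhds (hv a))
  refine h.congr fun z => ?_
  exact (sliceExt_slicePoint_eq hJ F z.1 z.2).symm

theorem ae_hasNTBL_sliceExt_poissonIntegral {p : ℝ} (hp : 1 ≤ p) {g : ℝ → Cl n}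
    (hg : MemLp g (ENNReal.ofReal p) volume) (I : EuclideanSpace ℝ (Fin n)) :
    ∀ᵐ v : ℝ, ∀ J ∈ imagSphere n, HasNTBL (sliceExt I (poissonIntegral g)) J v
      (sliceCombination I J (g (-v)) (g v)) := by
  have h := ae_tendsto_poissonKernel_cone hp hg
  -- Both `v` and `-v` must be good points; reflection preserves null sets.
  have h' := (Measure.measurePreserving_neg (volume : Measure ℝ)).quasiMeasurePreserving.ae h
  filter_upwards [h, h'] with v hv hv' J hJ
  exact hasNTBL_sliceExt hJ hv hv'

theorem lintegral_enorm_rpow_lt_top {E : Type*} [NormedAddCommGroup E] {p : ℝ} (hp : 1 ≤ p)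
    {g : ℝ → E} (hg : MemLp g (ENNReal.ofReal p) volume) : ∫⁻ v, ‖g v‖ₑ ^ p < ⊤ := by
  have hp0 : 0 < p := by linarith
  have h := lintegral_rpow_enorm_lt_top_of_eLpNorm_lt_top (by simpa using hp0)
    ENNReal.ofReal_ne_top hg.2
  rwa [ENNReal.toReal_ofReal hp0.le] at h

end

end SliceHardy

end

/-! ### The theorem -/

theorem mainTheorem2 (n : ℕ) (p : ℝ) (hp1 : 1 ≤ p) (hp2 : p ≤ 2)
    (I : EuclideanSpace ℝ (Fin n)) (hI : I ∈ SliceHardy.imagSphere n)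
    (g : ℝ → SliceHardy.Cl n) (hg : MemLp g (ENNReal.ofReal p) volume)
    (hsupp : SliceHardy.CliffFourierSupportedIn I p g (Set.Iic 0))
    (f : SliceHardy.Paravector n → SliceHardy.Cl n)
    (hf : f = SliceHardy.sliceExt I (SliceHardy.poissonIntegral g)) :
    SliceHardy.MemHardySlice p f ∧
      (∀ᵐ v : ℝ, SliceHardy.HasNTBL f I v (g v)) ∧
      (⨆ J ∈ SliceHardy.imagSphere n, ⨆ u ∈ Set.Ioi (0 : ℝ),
        ∫⁻ v : ℝ, ‖f (SliceHardy.slicePoint J u v)‖ₑ ^ p) < ⊤ := by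
  subst hf
  have hw := SliceHardy.integrable_inv_one_add_sq_smul hp1 hg
  have hNT := SliceHardy.ae_hasNTBL_sliceExt_poissonIntegral hp1 hg I
  obtain ⟨C, hC, hbound⟩ := SliceHardy.exists_lintegral_sliceCombination_le I hp1
  have hfin : C * ∫⁻ v, ‖g v‖ₑ ^ p < ⊤ :=
    ENNReal.mul_lt_top hC.lt_top (SliceHardy.lintegral_enorm_rpow_lt_top hp1 hg)
  refine ⟨⟨?_, fun J v => SliceHardy.sliceCombination I J (g (-v)) (g v),
    fun J hJ => hNT.mono fun v hv => hv J hJ, ?_⟩, ?_, ?_⟩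
  · exact SliceHardy.sliceMonogenicOn_sliceExt hI
      (fun u v hu => SliceHardy.hasFDerivAt_poissonIntegral hw hu v)
      (fun u v hu => SliceHardy.poissonIntegral_cauchyRiemann hI hp1 hg hsupp hu v)
  · exact (iSup₂_le fun J hJ => hbound J hJ g hg.1).trans_lt hfin
  · filter_upwards [hNT] with v hv
    simpa only [SliceHardy.sliceCombination_self hI] using hv I hI
  · refine (iSup₂_le fun J hJ => iSup₂_le fun u hu => ?_).trans_lt hfin
    -- Needed only for measurability of the function on the vertical line at height `u`.
    have hcont : Continuous (SliceHardy.poissonIntegral g u) :=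
      continuous_iff_continuousAt.2 fun v =>
        (SliceHardy.hasDerivAt_poissonIntegral_snd hw hu v).continuousAt
    simp only [SliceHardy.sliceExt_slicePoint_eq hJ]
    refine (hbound J hJ _ hcont.aestronglyMeasurable).trans ?_
    exact mul_le_mul_right
      (SliceHardy.lintegral_enorm_integral_poissonKernel_smul_rpow_le hg.1 hp1 hu) C
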